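/- Let $q_0,q_1,q_2\in\mathbb R^2$ be the vertices of an equilateral triangle (indices are read modulo $3$), let $F_i(x)=\tfrac12(x-q_i)+q_i$, and let $SG$ be the Sierpinski gasket, i.e. the unique nonempty compact set with $SG=\bigcup_{i=0}^2F_i(SG)$. Let $\mu$ be the Borel probability measure on $SG$ which gives each level-$m$ cell $F_{w_1}\circ\cdots\circ F_{w_m}(SG)$ the mass $3^{-m}$, and write $L^2(SG)$ for the real Hilbert space $L^2(SG,\mu)$. Let $V_0=\{q_0,q_1,q_2\}$ and $V_m=\bigcup_iF_i(V_{m-1})$; distinct $x,y\in V_m$ are called adjacent, $x\sim_m y$, if they belong to a common level-$m$ cell, and $\Delta_mu(x)=\sum_{y\sim_mx}(u(y)-u(x))$ for $x\in V_m\setminus V_0$. For continuous $u,f:SG\to\mathbb R$ write $\Delta u=f$ if $\tfrac32 5^m\Delta_mu\to f$ as $m\to\infty$, uniformly on $V_m\setminus V_0$. Put $$\partial_nu(q_i)=\lim_{m\to\infty}\left(\tfrac53\right)^m\bigl(2u(q_i)-u(F_i^mq_{i+1})-u(F_i^mq_{i-1})\bigr),\qquad \partial_Tu(q_i)=\lim_{m\to\infty}5^m\bigl(u(F_i^mq_{i+1})-u(F_i^mq_{i-1})\bigr).$$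 For $j\ge0$, $n\in\{0,1,2\}$ and $i\in\{1,2,3\}$ let the monomial $P_{ji}^{(n)}$ be the unique solution of $\Delta^{j+1}P=0$ on $SG$ such that, for $0\le m\le j$, $$\Delta^mP(q_n)=\delta_{mj}\delta_{i1},\qquad \partial_n\Delta^mP(q_n)=\delta_{mj}\delta_{i2},\qquad \partial_T\Delta^mP(q_n)=\delta_{mj}\delta_{i3}$$ (in $\partial_n$ the subscript stands for "normal"). For each $i=0,1,2$ let $\{Q^{(i)}_j\}_{j\ge0}$ be the orthonormal sequence obtained from $\{P^{(i)}_{j3}\}_{j\ge0}$ by the Gram–Schmidt process in $L^2(SG)$ followed by normalization, and let $\{S_j\}_{j\ge0}$ be the orthonormal sequence obtained in the same way from $\rho_j=P^{(0)}_{j1}+P^{(1)}_{j1}+P^{(2)}_{j1}$, $j\ge0$. Then the family $$\phi^{(i)}_j=\sqrt{\tfrac23}\,Q^{(i)}_j+\sqrt{\tfrac13}\,S_j,\qquad i=0,1,2,\ j\ge0,$$ is orthonormal in $L^2(SG)$, and it is an orthonormal (Hilbert) basis of a closed subspace $\mathcal P$ of $L^2(SG)$. -/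

import Mathlib

open Filter Topology MeasureTheory

noncomputable section

namespace SierpinskiGasket

abbrev Plane : Type := EuclideanSpace ℝ (Fin 2)

/-- `q 0, q 1, q 2` are the vertices of a (nondegenerate) equilateral triangle. -/
def IsEquilateral (q : Fin 3 → Plane) : Prop :=
  ∃ s : ℝ, 0 < s ∧ ∀ i j : Fin 3, i ≠ j → dist (q i) (q j) = s

/-! ### The gasket as the attractor of three half-scale contractions -/

/-- The contraction `F_i x = (x - q_i) / 2 + q_i` of the plane. -/
def contraction (q : Fin 3 → Plane) (i : Fin 3) (x : Plane) : Plane :=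
  (1 / 2 : ℝ) • (x - q i) + q i

/-- The point with address `w`, that is, `lim_m F_{w 0} ∘ ⋯ ∘ F_{w m} (x)` for any `x`. -/
def address (q : Fin 3 → Plane) (w : ℕ → Fin 3) : Plane :=
  ∑' k : ℕ, (1 / 2 : ℝ) ^ (k + 1) • q (w k)

/-- The Sierpinski gasket, as the set of all points with an address. By `nonempty_SG`,
`isCompact_SG` and `SG_eq_iUnion` it is the attractor of the three contractions, which is the
unique nonempty compact set satisfying the self-similar identity. -/
def SG (q : Fin 3 → Plane) : Set Plane := Set.range (address q)

theorem norm_term_le (q : Fin 3 → Plane) (w : ℕ → Fin 3) (k : ℕ) :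
    ‖(1 / 2 : ℝ) ^ (k + 1) • q (w k)‖ ≤ (1 / 2 : ℝ) ^ k * ∑ i, ‖q i‖ := by
  have h1 : ‖q (w k)‖ ≤ ∑ i, ‖q i‖ :=
    Finset.single_le_sum (f := fun i => ‖q i‖) (fun i _ => norm_nonneg _) (Finset.mem_univ _)
  rw [norm_smul, norm_pow]
  have h2 : ‖(1 / 2 : ℝ)‖ = 1 / 2 := by norm_num
  rw [h2, pow_succ]
  have h3 : (0 : ℝ) ≤ (1 / 2) ^ k := by positivity
  have h4 : (1 / 2 : ℝ) ^ k * (1 / 2) ≤ (1 / 2) ^ k := by linarith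
  exact mul_le_mul h4 h1 (norm_nonneg _) h3

theorem summable_bound (q : Fin 3 → Plane) :
    Summable fun k : ℕ => (1 / 2 : ℝ) ^ k * ∑ i, ‖q i‖ :=
  (summable_geometric_of_lt_one (by norm_num) (by norm_num)).mul_right _

theorem summable_address (q : Fin 3 → Plane) (w : ℕ → Fin 3) :
    Summable fun k : ℕ => (1 / 2 : ℝ) ^ (k + 1) • q (w k) :=
  Summable.of_norm_bounded (summable_bound q) (norm_term_le q w)

theorem continuous_address (q : Fin 3 → Plane) : Continuous (address q) := by
  refine continuous_tsum (fun k => ?_) (summable_bound q) (fun k w => norm_term_le q w k)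
  have h1 : Continuous q := continuous_of_discreteTopology
  have h2 : Continuous fun w : ℕ → Fin 3 => w k := continuous_apply k
  exact (h1.comp h2).const_smul ((1 / 2 : ℝ) ^ (k + 1))

/-- Prefixing the letter `i` to an address amounts to applying `F_i`. -/
theorem contraction_address (q : Fin 3 → Plane) (i : Fin 3) (w : ℕ → Fin 3) :
    contraction q i (address q w) = address q (fun k => Nat.casesOn k i w) := by
  have h := (summable_address q (fun k => Nat.casesOn k i w)).tsum_eq_zero_add
  simp only [address] at h ⊢
  rw [h, contraction]
  have h2 : (∑' k : ℕ, (1 / 2 : ℝ) ^ (k + 1 + 1) • q (w k))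
      = (1 / 2 : ℝ) • ∑' k : ℕ, (1 / 2 : ℝ) ^ (k + 1) • q (w k) := by
    rw [← (summable_address q w).tsum_const_smul]
    refine tsum_congr fun k => ?_
    rw [smul_smul, pow_succ' _ (k + 1)]
  rw [h2]
  module

theorem nonempty_SG (q : Fin 3 → Plane) : (SG q).Nonempty := Set.range_nonempty _

theorem isCompact_SG (q : Fin 3 → Plane) : IsCompact (SG q) :=
  isCompact_range (continuous_address q)

theorem contraction_mem_SG (q : Fin 3 → Plane) (i : Fin 3) {x : Plane} (hx : x ∈ SG q) :
    contraction q i x ∈ SG q := by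
  obtain ⟨w, rfl⟩ := hx
  exact ⟨_, (contraction_address q i w).symm⟩

theorem SG_eq_iUnion (q : Fin 3 → Plane) : SG q = ⋃ i, contraction q i '' SG q := by
  refine Set.Subset.antisymm ?_ (Set.iUnion_subset fun i => ?_)
  · rintro _ ⟨w, rfl⟩
    refine Set.mem_iUnion.2 ⟨w 0, address q (fun k => w (k + 1)), ⟨_, rfl⟩, ?_⟩
    rw [contraction_address]
    congr 1
    funext k
    cases k <;> rfl
  · rintro _ ⟨x, hx, rfl⟩
    exact contraction_mem_SG q i hx

theorem vertex_mem_SG (q : Fin 3 → Plane) (i : Fin 3) : q i ∈ SG q := by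
  refine ⟨fun _ => i, ?_⟩
  have h := contraction_address q i (fun _ => i)
  have h2 : (fun k : ℕ => (Nat.casesOn k i (fun _ => i) : Fin 3)) = fun _ => i := by
    funext k
    cases k <;> rfl
  rw [h2] at h
  have h3 : (1 / 2 : ℝ) • (address q (fun _ => i) - q i) = 0 := by
    have : (1 / 2 : ℝ) • (address q (fun _ => i) - q i)
        = address q (fun _ => i) - contraction q i (address q (fun _ => i)) := by
      rw [contraction]; module
    rw [this, h, sub_self]
  have h4 : address q (fun _ => i) - q i = 0 := by
    rcases smul_eq_zero.1 h3 with h5 | h5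
    · norm_num at h5
    · exact h5
  exact sub_eq_zero.1 h4

instance instCompactSpaceSG (q : Fin 3 → Plane) : CompactSpace (SG q) :=
  isCompact_iff_compactSpace.1 (isCompact_SG q)

/-! ### The self-similar measure and `L²(SG)` -/

/-- The address map with values in the gasket. -/
def addressSG (q : Fin 3 → Plane) (w : ℕ → Fin 3) : SG q := ⟨address q w, w, rfl⟩

theorem measurable_addressSG (q : Fin 3 → Plane) : Measurable (addressSG q) :=
  ((continuous_address q).subtype_mk _).measurable

/-- The natural self-similar probability measure on the gasket: the law of the point whose address
is a sequence of independent uniform letters. Each cell of level `m` has mass `3 ^ (-m)`. -/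
def mu (q : Fin 3 → Plane) : Measure (SG q) :=
  (Measure.infinitePi fun _ : ℕ => (PMF.uniformOfFintype (Fin 3)).toMeasure).map (addressSG q)

instance instIsProbabilityMeasureMu (q : Fin 3 → Plane) : IsProbabilityMeasure (mu q) :=
  Measure.isProbabilityMeasure_map (measurable_addressSG q).aemeasurable

/-- The real Hilbert space `L²(SG)`. -/
abbrev L2SG (q : Fin 3 → Plane) : Type := Lp ℝ 2 (mu q)

/-- The class in `L²(SG)` of a continuous function. -/
def toL2 (q : Fin 3 → Plane) (u : C(SG q, ℝ)) : L2SG q := ContinuousMap.toLp 2 (mu q) ℝ u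

/-! ### Vertices, graphs and the Laplacian -/

/-- The boundary point `q_i` of the gasket. -/
def corner (q : Fin 3 → Plane) (i : Fin 3) : SG q := ⟨q i, vertex_mem_SG q i⟩

/-- The contraction `F_i` as a self-map of the gasket. -/
def cell (q : Fin 3 → Plane) (i : Fin 3) (x : SG q) : SG q :=
  ⟨contraction q i x, contraction_mem_SG q i x.2⟩

/-- `F_w = F_{w_1} ∘ ⋯ ∘ F_{w_m}` for a word `w = [w_1, …, w_m]`. -/
def cellWord (q : Fin 3 → Plane) : List (Fin 3) → SG q → SG q
  | [], x => x
  | i :: w, x => cell q i (cellWord q w x)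

open Classical in
/-- The vertex set `V_m`. -/
def vertices (q : Fin 3 → Plane) : ℕ → Finset (SG q)
  | 0 => Finset.univ.image (corner q)
  | m + 1 => Finset.univ.biUnion fun i => (vertices q m).image (cell q i)

/-- The edge relation of level `m`: two distinct vertices are adjacent when they are corners of a
common cell of level `m`. -/
def graph (q : Fin 3 → Plane) (m : ℕ) : SimpleGraph (SG q) where
  Adj x y := x ≠ y ∧ ∃ w : List (Fin 3), w.length = m ∧
    ∃ i j : Fin 3, x = cellWord q w (corner q i) ∧ y = cellWord q w (corner q j)
  symm := ⟨by
    rintro x y ⟨h, w, hw, i, j, hx, hy⟩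
    exact ⟨h.symm, w, hw, j, i, hy, hx⟩⟩
  loopless := ⟨fun _ h => h.1 rfl⟩

open Classical in
/-- The graph Laplacian of level `m`: the sum of `u y - u x` over the neighbours `y` of `x`. -/
def graphLaplacian (q : Fin 3 → Plane) (m : ℕ) (u : SG q → ℝ) (x : SG q) : ℝ :=
  ∑ y ∈ vertices q m with (graph q m).Adj x y, (u y - u x)

/-- `u` is in the domain of the Laplacian and `Δ u = f`: the renormalized graph Laplacians
`(3/2) 5^m Δ_m u` converge to the continuous function `f`, uniformly over the junction points. -/
def HasLaplacian (q : Fin 3 → Plane) (u f : C(SG q, ℝ)) : Prop :=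
  ∀ ε : ℝ, 0 < ε → ∃ M : ℕ, ∀ m : ℕ, M ≤ m → ∀ x ∈ vertices q m, x ∉ vertices q 0 →
    |3 / 2 * 5 ^ m * graphLaplacian q m u x - f x| < ε

/-- `Δ^k u = f`. -/
def HasIterLaplacian (q : Fin 3 → Plane) : ℕ → C(SG q, ℝ) → C(SG q, ℝ) → Prop
  | 0, u, f => u = f
  | k + 1, u, f => ∃ v, HasLaplacian q u v ∧ HasIterLaplacian q k v f

/-- The normal derivative of `u` at `q_n` exists and equals `d` (indices modulo 3). -/
def HasNormalDeriv (q : Fin 3 → Plane) (u : SG q → ℝ) (n : Fin 3) (d : ℝ) : Prop :=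
  Tendsto (fun m : ℕ => (5 / 3 : ℝ) ^ m *
    (2 * u (corner q n) - u ((cell q n)^[m] (corner q (n + 1)))
      - u ((cell q n)^[m] (corner q (n - 1))))) atTop (𝓝 d)

/-- The tangential derivative of `u` at `q_n` exists and equals `d` (indices modulo 3). -/
def HasTangentialDeriv (q : Fin 3 → Plane) (u : SG q → ℝ) (n : Fin 3) (d : ℝ) : Prop :=
  Tendsto (fun m : ℕ => (5 : ℝ) ^ m *
    (u ((cell q n)^[m] (corner q (n + 1))) - u ((cell q n)^[m] (corner q (n - 1)))))
    atTop (𝓝 d)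

/-! ### Polynomials, monomials and orthogonal polynomials -/

/-- The space `H^j` of polynomials of degree at most `j`: the solutions of `Δ^(j+1) u = 0`. -/
def polynomials (q : Fin 3 → Plane) (j : ℕ) : Set C(SG q, ℝ) :=
  {u | HasIterLaplacian q (j + 1) u 0}

/-- `P` is the monomial `P_{ji}^{(n)}`, `i = 1, 2, 3`: the element of `H^j` for which, for all
`m ≤ j`, the function `f = Δ^m P` has, at `q_n`, value `δ_{mj} δ_{i1}`, normal derivative
`δ_{mj} δ_{i2}` and tangential derivative `δ_{mj} δ_{i3}`. -/
def IsMonomial (q : Fin 3 → Plane) (n : Fin 3) (j i : ℕ) (P : C(SG q, ℝ)) : Prop :=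
  P ∈ polynomials q j ∧ ∀ m ≤ j, ∃ f : C(SG q, ℝ), HasIterLaplacian q m P f ∧
    f (corner q n) = (if m = j ∧ i = 1 then 1 else 0) ∧
    HasNormalDeriv q f n (if m = j ∧ i = 2 then 1 else 0) ∧
    HasTangentialDeriv q f n (if m = j ∧ i = 3 then 1 else 0)

open Classical in
/-- The monomial `P_{ji}^{(n)}`, selected by its defining property. The value `0` is a placeholder
that would be taken only if no such function existed. -/
def monomial (q : Fin 3 → Plane) (n : Fin 3) (j i : ℕ) : C(SG q, ℝ) :=
  if h : ∃ P, IsMonomial q n j i P then h.choose else 0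

/-- The fully symmetric monomial `ρ_j = P_{j1}^{(0)} + P_{j1}^{(1)} + P_{j1}^{(2)}`. -/
def symMonomial (q : Fin 3 → Plane) (j : ℕ) : C(SG q, ℝ) := ∑ n : Fin 3, monomial q n j 1

/-- `Q_j^{(n)}`: the antisymmetric orthonormal polynomials, by the Gram-Schmidt process in
`L²(SG)` (with normalization) from `P_{03}^{(n)}, P_{13}^{(n)}, …`. -/
def antisymOP (q : Fin 3 → Plane) (n : Fin 3) (j : ℕ) : L2SG q :=
  InnerProductSpace.gramSchmidtNormed ℝ (fun k : ℕ => toL2 q (monomial q n k 3)) j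

/-- `S_j`: the symmetric orthonormal polynomials, by the Gram-Schmidt process in `L²(SG)` (with
normalization) from `ρ_0, ρ_1, …`. -/
def symOP (q : Fin 3 → Plane) (j : ℕ) : L2SG q :=
  InnerProductSpace.gramSchmidtNormed ℝ (fun k : ℕ => toL2 q (symMonomial q k)) j

/-- `φ_j^{(i)} = √(2/3) Q_j^{(i)} + √(1/3) S_j`. -/
def phi (q : Fin 3 → Plane) (j : ℕ) (i : Fin 3) : L2SG q :=
  √(2 / 3 : ℝ) • antisymOP q i j + √(1 / 3 : ℝ) • symOP q j

end SierpinskiGasket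

end

noncomputable section

namespace SierpinskiGasket

/-! ### Barycentric coordinates -/

/-! The orthonormality is a computation with symmetries. `antisymOP q n j` is odd under the
reflection fixing $q_n$, while `symOP q k` is invariant, so the two are orthogonal. The same
reflection exchanges the two other vertices, so the inner product of `antisymOP q n j` with
`antisymOP q l k` is the same for both $l\ne n$. Since the three antisymmetric polynomials of a
given index add up to zero (`sum_antisymOP`), this common value is $-\delta_{jk}/2$. The weights of
`phi` are made for this: $\frac23+\frac13=1$ on the diagonal and $\frac23\cdot(-\frac12)+\frac13=0$
between different vertices. The Hilbert basis is then formal: an orthonormal family embeds $\ell^2$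
isometrically, and the range is closed.

The vanishing sum comes from `sum_monomial_three`. The sum of the three monomials $P_{j3}^{(n)}$ is
odd under all three reflections, so it vanishes at the vertices; by induction on $j$ its Laplacian
is zero, and the maximum principle finishes. Rotations are isometries, hence commute with
Gram–Schmidt and carry the relation over to the orthonormal polynomials.

Most of the work makes this calculus legitimate. `monomial` is a choice with fallback value $0$, so
monomials must be shown to exist and to be unique. Existence rests on solving $\Delta u=f$:
`poisson` is built by subdivision, with junction values chosen so that the normal derivatives from
the two adjacent cells cancel (`flux_subdivide_add`). A parity projection and a harmonic correction
make the primitive homogeneous under $F_n$, which forces its jet at $q_n$ to vanish. Uniqueness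
comes from the maximum principle, and it yields the symmetry rules of the monomials. Finally,
Gram–Schmidt needs linear independence: the monomials form chains under $\Delta$, and `mu` charges
every nonempty open set, so independence survives in $L^2$. -/

/-- A continuous function on a compact space whose value at each point is at least half of some
other value is nonnegative. -/
theorem nonneg_of_half_le {X : Type*} [TopologicalSpace X] [CompactSpace X] {f : X → ℝ}
    (hf : Continuous f) (h : ∀ x, ∃ y, f y / 2 ≤ f x) (x : X) : 0 ≤ f x := by
  obtain ⟨z, -, hz⟩ := isCompact_univ.exists_isMinOn ⟨x, Set.mem_univ x⟩ hf.continuousOn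
  obtain ⟨y, hy⟩ := h z
  have h1 : f z ≤ f y := hz (Set.mem_univ y)
  have h2 : f z ≤ f x := hz (Set.mem_univ x)
  linarith

/-- This turns self-similarity into identities: a defect that halves whenever one letter is removed
vanishes by compactness. -/
theorem eq_zero_of_norm_le_half {X E : Type*} [TopologicalSpace X] [CompactSpace X]
    [NormedAddCommGroup E] {f : X → E} (hf : Continuous f) (h : ∀ x, ∃ y, ‖f x‖ ≤ ‖f y‖ / 2)
    (x : X) : f x = 0 := by
  have h1 := nonneg_of_half_le (f := fun x => -‖f x‖) hf.norm.neg
    (fun x => (h x).imp fun y hy => by linarith) x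
  exact norm_le_zero_iff.1 (by linarith)

/-- The centroid of the triangle. -/
def centroid (q : Fin 3 → Plane) : Plane := (1 / 3 : ℝ) • ∑ k, q k

/-- The barycentric coordinates with respect to an equilateral triangle. -/
def bary (q : Fin 3 → Plane) (k : Fin 3) (x : Plane) : ℝ :=
  1 / 3 + 2 / dist (q 0) (q 1) ^ 2 * inner ℝ (x - centroid q) (q k - centroid q)

theorem continuous_bary (q : Fin 3 → Plane) (k : Fin 3) : Continuous (bary q k) := by
  unfold bary; fun_prop

/-- Seen from the centroid of a triangle of side $s$, the vertices have inner products $s^2/3$ on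
the diagonal and $-s^2/6$ off it; this fixes the factor $2/s^2$ in `bary`. -/
theorem bary_vertex {q : Fin 3 → Plane} (hq : IsEquilateral q) (k l : Fin 3) :
    bary q k (q l) = if k = l then 1 else 0 := by
  obtain ⟨s, hs, h⟩ := hq
  have h' : ∀ i j : Fin 3, i ≠ j →
      inner ℝ (q i) (q i) - 2 * inner ℝ (q i) (q j) + inner ℝ (q j) (q j) = s ^ 2 := by
    intro i j hij
    rw [← h i j hij, dist_eq_norm, norm_sub_sq_real, real_inner_self_eq_norm_sq,
      real_inner_self_eq_norm_sq]
  have h01 := h' 0 1 (by decide)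
  have h02 := h' 0 2 (by decide)
  have h12 := h' 1 2 (by decide)
  have e1 := real_inner_comm (q 0) (q 1)
  have e2 := real_inner_comm (q 0) (q 2)
  have e3 := real_inner_comm (q 1) (q 2)
  have key : inner ℝ (q l - centroid q) (q k - centroid q)
      = s ^ 2 / 2 * ((if k = l then 1 else 0) - 1 / 3) := by
    simp only [centroid, Fin.sum_univ_three, inner_sub_left, inner_sub_right, inner_add_left,
      inner_add_right, inner_smul_left, inner_smul_right, conj_trivial]
    simp only [real_inner_self_eq_norm_sq] at h01 h02 h12
    fin_cases k <;> fin_cases l <;> simp <;> linarith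
  rw [bary, key, h 0 1 (by decide)]
  field_simp
  ring

theorem sum_bary (q : Fin 3 → Plane) (x : Plane) : ∑ k, bary q k x = 1 := by
  have h : ∑ k, inner ℝ (x - centroid q) (q k - centroid q) = 0 := by
    rw [← inner_sum, Finset.sum_sub_distrib]
    have : ∑ k, q k - ∑ _k : Fin 3, centroid q = 0 := by
      simp only [Finset.sum_const, Finset.card_univ, Fintype.card_fin, centroid]
      module
    rw [this, inner_zero_right]
  simp only [bary, Finset.sum_add_distrib, ← Finset.mul_sum, h]
  norm_num

theorem bary_contraction {q : Fin 3 → Plane} (hq : IsEquilateral q) (k i : Fin 3) (x : Plane) :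
    bary q k (contraction q i x) = (bary q k x + if k = i then 1 else 0) / 2 := by
  rw [← bary_vertex hq k i]
  have h : contraction q i x - centroid q
      = (1 / 2 : ℝ) • (x - centroid q) + (1 / 2 : ℝ) • (q i - centroid q) := by
    rw [contraction]; module
  simp only [bary, h, inner_add_left, inner_smul_left, conj_trivial]
  ring

theorem cell_surjective (q : Fin 3 → Plane) (x : SG q) : ∃ i y, cell q i y = x := by
  obtain ⟨x, hx⟩ := x
  rw [SG_eq_iUnion, Set.mem_iUnion] at hx
  obtain ⟨i, y, hy, h⟩ := hx
  exact ⟨i, ⟨y, hy⟩, Subtype.ext h⟩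

theorem continuous_cell (q : Fin 3 → Plane) (i : Fin 3) : Continuous (cell q i) := by
  unfold cell contraction; fun_prop

theorem bary_nonneg {q : Fin 3 → Plane} (hq : IsEquilateral q) (k : Fin 3) (x : SG q) :
    0 ≤ bary q k x := by
  refine nonneg_of_half_le (f := fun x : SG q => bary q k x)
    ((continuous_bary q k).comp continuous_subtype_val) (fun x => ?_) x
  obtain ⟨i, y, rfl⟩ := cell_surjective q x
  refine ⟨y, ?_⟩
  change _ ≤ bary q k (contraction q i y)
  rw [bary_contraction hq]
  split_ifs <;> linarith

theorem bary_le_one {q : Fin 3 → Plane} (hq : IsEquilateral q) (k : Fin 3) (x : SG q) :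
    bary q k x ≤ 1 := by
  rw [← sum_bary q x]
  exact Finset.single_le_sum (f := fun k => bary q k x) (fun i _ => bary_nonneg hq i x)
    (Finset.mem_univ k)

theorem sum_bary_smul {q : Fin 3 → Plane} (hq : IsEquilateral q) (x : SG q) :
    ∑ k, bary q k x • q k = (x : Plane) := by
  have h := eq_zero_of_norm_le_half (f := fun x : SG q => ∑ k, bary q k x • q k - (x : Plane))
    (by
      have := continuous_bary q
      fun_prop) (fun x => ?_) x
  · exact sub_eq_zero.1 h
  obtain ⟨i, y, rfl⟩ := cell_surjective q x
  refine ⟨y, le_of_eq ?_⟩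
  have h2 : ∑ k, bary q k (cell q i y) • q k - (cell q i y : Plane)
      = (1 / 2 : ℝ) • (∑ k, bary q k y • q k - (y : Plane)) := by
    change ∑ k, bary q k (contraction q i y) • q k - contraction q i y = _
    have h3 : ∑ k, (if k = i then (1 : ℝ) else 0) • q k = q i := by simp
    simp only [bary_contraction hq]
    simp only [contraction, add_smul, Finset.sum_add_distrib, div_eq_inv_mul _ (2 : ℝ),
      mul_smul, ← Finset.smul_sum, h3]
    module
  rw [h2, norm_smul]
  norm_num
  ring

theorem eq_of_bary_eq {q : Fin 3 → Plane} (hq : IsEquilateral q) {x y : SG q}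
    (h : ∀ k, bary q k x = bary q k y) : x = y := by
  refine Subtype.ext ?_
  rw [← sum_bary_smul hq x, ← sum_bary_smul hq y]
  simp only [h]

theorem eq_corner_of_bary_eq_one {q : Fin 3 → Plane} (hq : IsEquilateral q) {x : SG q} {i : Fin 3}
    (h : bary q i x = 1) : x = corner q i := by
  refine eq_of_bary_eq hq fun k => ?_
  change _ = bary q k (q i)
  rw [bary_vertex hq]
  have h1 := sum_bary q x
  have h2 := bary_nonneg hq 0 x
  have h3 := bary_nonneg hq 1 x
  have h4 := bary_nonneg hq 2 x
  rw [Fin.sum_univ_three] at h1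
  fin_cases i <;> fin_cases k <;> simp at h ⊢ <;> linarith

theorem bary_corner {q : Fin 3 → Plane} (hq : IsEquilateral q) (k i : Fin 3) :
    bary q k (corner q i) = if k = i then 1 else 0 := bary_vertex hq k i

theorem bary_cell {q : Fin 3 → Plane} (hq : IsEquilateral q) (k i : Fin 3) (x : SG q) :
    bary q k (cell q i x) = (bary q k x + if k = i then 1 else 0) / 2 := bary_contraction hq k i x

theorem corner_injective {q : Fin 3 → Plane} (hq : IsEquilateral q) :
    Function.Injective (corner q) := by
  intro i j h
  by_contra hij
  have h1 := bary_corner hq i i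
  rw [h, bary_corner hq i j] at h1
  simp [hij] at h1

theorem cell_corner_self (q : Fin 3 → Plane) (i : Fin 3) : cell q i (corner q i) = corner q i := by
  refine Subtype.ext ?_
  change contraction q i (q i) = q i
  simp [contraction]

theorem cell_corner_comm (q : Fin 3 → Plane) (i j : Fin 3) :
    cell q i (corner q j) = cell q j (corner q i) := by
  refine Subtype.ext ?_
  change contraction q i (q j) = contraction q j (q i)
  rw [contraction, contraction]
  module

theorem cell_injective (q : Fin 3 → Plane) (i : Fin 3) : Function.Injective (cell q i) := by
  intro x y h
  have h1 : contraction q i x = contraction q i y := congrArg Subtype.val h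
  simp only [contraction, add_left_inj] at h1
  have h2 := smul_right_injective Plane (show (1 / 2 : ℝ) ≠ 0 by norm_num) h1
  exact Subtype.ext (sub_left_injective h2)

/-- Finite ramification: the $i$-th barycentric coordinate is at least $1/2$ on cell $i$ and at most
$1/2$ on cell $j$, so a common point has coordinate exactly $1/2$, and symmetrically for $j$. -/
theorem eq_corner_of_cell_eq {q : Fin 3 → Plane} (hq : IsEquilateral q) {i j : Fin 3}
    (hij : i ≠ j) {x y : SG q} (h : cell q i x = cell q j y) :
    x = corner q j ∧ y = corner q i := by
  have h1 := bary_cell hq i i x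
  have h2 := bary_cell hq j i x
  rw [h, bary_cell hq] at h1 h2
  have e := bary_nonneg hq i x
  have e' := bary_nonneg hq j y
  have e2 := bary_le_one hq i y
  have e3 := bary_le_one hq j x
  simp only [hij, hij.symm, if_true, if_false] at h1 h2
  exact ⟨eq_corner_of_bary_eq_one hq (by linarith), eq_corner_of_bary_eq_one hq (by linarith)⟩

theorem eq_corner_of_cell_eq_corner {q : Fin 3 → Plane} (hq : IsEquilateral q) {i j : Fin 3}
    {x : SG q} (h : cell q i x = corner q j) : i = j ∧ x = corner q i := by
  rcases eq_or_ne i j with rfl | hij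
  · exact ⟨rfl, cell_injective q i (h.trans (cell_corner_self q i).symm)⟩
  · rw [← cell_corner_self] at h
    exact absurd (corner_injective hq (eq_corner_of_cell_eq hq hij h).2) hij.symm

/-! ### Gluing -/

/-- Continuous functions on the three cells of level one that agree at the junction points
come from a continuous function on the gasket. -/
theorem exists_glue {q : Fin 3 → Plane} (hq : IsEquilateral q) (v : Fin 3 → C(SG q, ℝ))
    (h : ∀ i j, v i (corner q j) = v j (corner q i)) :
    ∃ u : C(SG q, ℝ), ∀ i x, u (cell q i x) = v i x := by
  let π : C(Fin 3 × SG q, SG q) := ⟨fun p => cell q p.1 p.2, by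
    refine continuous_prod_of_discrete_left.2 fun i => continuous_cell q i⟩
  -- A continuous surjection from a compact space onto a Hausdorff space is a quotient map, so
  -- continuity of the glued function is automatic.
  have hπ : IsQuotientMap π := by
    refine IsQuotientMap.of_surjective_continuous ?_ π.continuous
    intro x
    obtain ⟨i, y, rfl⟩ := cell_surjective q x
    exact ⟨(i, y), rfl⟩
  let V : C(Fin 3 × SG q, ℝ) := ⟨fun p => v p.1 p.2,
    continuous_prod_of_discrete_left.2 fun i => (v i).continuous⟩
  have hV : ∀ a b, π a = π b → V a = V b := by
    rintro ⟨i, x⟩ ⟨j, y⟩ hab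
    change cell q i x = cell q j y at hab
    change v i x = v j y
    rcases eq_or_ne i j with rfl | hij
    · rw [cell_injective q i hab]
    · obtain ⟨rfl, rfl⟩ := eq_corner_of_cell_eq hq hij hab
      exact h i j
  refine ⟨hπ.lift V hV, fun i x => ?_⟩
  exact congrArg (fun f : C(Fin 3 × SG q, ℝ) => f (i, x)) (hπ.lift_comp V hV)

/-! ### Words -/

theorem dist_cell (q : Fin 3 → Plane) (i : Fin 3) (x y : SG q) :
    dist (cell q i x) (cell q i y) = dist x y / 2 := by
  change dist (contraction q i x) (contraction q i y) = dist (x : Plane) y / 2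
  rw [contraction, contraction, dist_add_right, dist_eq_norm, ← smul_sub, norm_smul,
    sub_sub_sub_cancel_right, dist_eq_norm]
  norm_num
  ring

theorem dist_cellWord (q : Fin 3 → Plane) (w : List (Fin 3)) (x y : SG q) :
    dist (cellWord q w x) (cellWord q w y) = dist x y / 2 ^ w.length := by
  induction w with
  | nil => simp [cellWord]
  | cons i w ih =>
    rw [cellWord, cellWord, dist_cell, ih, List.length_cons, pow_succ, div_div]

theorem exists_cellWord (q : Fin 3 → Plane) (m : ℕ) (x : SG q) :
    ∃ w : List (Fin 3), w.length = m ∧ ∃ y, cellWord q w y = x := by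
  induction m generalizing x with
  | zero => exact ⟨[], rfl, x, rfl⟩
  | succ m ih =>
    obtain ⟨i, y, rfl⟩ := cell_surjective q x
    obtain ⟨w, hw, z, rfl⟩ := ih y
    exact ⟨i :: w, by simp [hw], z, rfl⟩

theorem cellWord_append (q : Fin 3 → Plane) (v w : List (Fin 3)) (x : SG q) :
    cellWord q (v ++ w) x = cellWord q v (cellWord q w x) := by
  induction v with
  | nil => rfl
  | cons i v ih => rw [List.cons_append, cellWord, ih, cellWord]

theorem cellWord_replicate (q : Fin 3 → Plane) (i : Fin 3) (m : ℕ) (x : SG q) :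
    cellWord q (List.replicate m i) x = (cell q i)^[m] x := by
  induction m with
  | zero => rfl
  | succ m ih => rw [List.replicate_succ, cellWord, ih, Function.iterate_succ_apply']

theorem mem_vertices (q : Fin 3 → Plane) {m : ℕ} {x : SG q} :
    x ∈ vertices q m ↔ ∃ w : List (Fin 3), w.length = m ∧ ∃ i, x = cellWord q w (corner q i) := by
  induction m generalizing x with
  | zero =>
    simp only [vertices, Finset.mem_image, Finset.mem_univ, true_and, List.length_eq_zero_iff]
    constructor
    · rintro ⟨i, rfl⟩
      exact ⟨[], rfl, i, rfl⟩
    · rintro ⟨w, rfl, i, rfl⟩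
      exact ⟨i, rfl⟩
  | succ m ih =>
    simp only [vertices, Finset.mem_biUnion, Finset.mem_image, Finset.mem_univ, true_and, ih]
    constructor
    · rintro ⟨j, y, ⟨w, hw, i, rfl⟩, rfl⟩
      exact ⟨j :: w, by simp [hw], i, rfl⟩
    · rintro ⟨w, hw, i, rfl⟩
      obtain ⟨j, w, rfl⟩ := List.exists_cons_of_length_eq_add_one hw
      exact ⟨j, _, ⟨w, by simpa using hw, i, rfl⟩, rfl⟩

theorem mem_vertices_zero (q : Fin 3 → Plane) {x : SG q} :
    x ∈ vertices q 0 ↔ ∃ i, x = corner q i := by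
  simp [vertices, eq_comm]

theorem vertices_mono (q : Fin 3 → Plane) {m n : ℕ} (h : m ≤ n) : vertices q m ⊆ vertices q n := by
  intro x hx
  rw [mem_vertices] at hx ⊢
  obtain ⟨w, hw, i, rfl⟩ := hx
  refine ⟨w ++ List.replicate (n - m) i, by simp [hw, h], i, ?_⟩
  rw [cellWord_append, cellWord_replicate, Function.iterate_fixed (cell_corner_self q i)]

theorem cell_mem_vertices (q : Fin 3 → Plane) {m : ℕ} {x : SG q} (hx : x ∈ vertices q m)
    (i : Fin 3) : cell q i x ∈ vertices q (m + 1) := by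
  simp only [vertices, Finset.mem_biUnion, Finset.mem_image, Finset.mem_univ, true_and]
  exact ⟨i, x, hx, rfl⟩

theorem cell_notMem_vertices_zero {q : Fin 3 → Plane} (hq : IsEquilateral q) {x : SG q}
    (hx : x ∉ vertices q 0) (i : Fin 3) : cell q i x ∉ vertices q 0 := by
  rw [mem_vertices_zero] at hx ⊢
  rintro ⟨j, hj⟩
  exact hx ⟨i, (eq_corner_of_cell_eq_corner hq hj).2⟩

theorem cell_corner_notMem_vertices_zero {q : Fin 3 → Plane} (hq : IsEquilateral q) {i j : Fin 3}
    (hij : i ≠ j) : cell q i (corner q j) ∉ vertices q 0 := by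
  rw [mem_vertices_zero]
  rintro ⟨k, hk⟩
  exact hij (corner_injective hq (eq_corner_of_cell_eq_corner hq hk).2).symm

/-- The junction points of all levels are dense in the gasket. -/
theorem dense_junctions {q : Fin 3 → Plane} (hq : IsEquilateral q) :
    Dense {x : SG q | (∃ m, x ∈ vertices q m) ∧ x ∉ vertices q 0} := by
  rw [Metric.dense_iff]
  intro x r hr
  obtain ⟨D, hD⟩ := Metric.isBounded_iff.1 (isCompact_univ (X := SG q)).isBounded
  have h1 : Tendsto (fun m : ℕ => D / 2 ^ m) atTop (𝓝 0) := by
    have := (tendsto_pow_atTop_nhds_zero_of_lt_one (r := (1 / 2 : ℝ)) (by norm_num)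
      (by norm_num)).const_mul D
    simpa [div_eq_mul_inv] using this
  obtain ⟨m, hm⟩ := (h1.eventually (gt_mem_nhds hr)).exists
  obtain ⟨w, hw, y, rfl⟩ := exists_cellWord q m x
  refine ⟨cellWord q w (cell q 0 (corner q 1)), ?_, ⟨m + 1, ?_⟩, ?_⟩
  · rw [Metric.mem_ball, dist_cellWord, hw]
    refine lt_of_le_of_lt ?_ hm
    gcongr
    exact hD (Set.mem_univ _) (Set.mem_univ _)
  · rw [mem_vertices]
    exact ⟨w ++ [0], by simp [hw], 1, by rw [cellWord_append]; rfl⟩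
  · clear hw
    induction w with
    | nil => exact cell_corner_notMem_vertices_zero hq (by decide)
    | cons i w ih => exact cell_notMem_vertices_zero hq ih i

/-! ### Functions defined by self-similar subdivision of their boundary values -/

/-- A family of continuous functions indexed by states, where a state prescribes the boundary values
and the states of the three restrictions to cells, exists as soon as the prescriptions are
compatible and the oscillation decays geometrically under subdivision. -/
theorem exists_of_subdivision {q : Fin 3 → Plane} (hq : IsEquilateral q) {S : Type*}
    (b : S → Fin 3 → ℝ) (σ : Fin 3 → S → S) (N : S → ℝ) {r : ℝ} (hr0 : 0 ≤ r) (hr1 : r < 1)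
    (hN : ∀ s i j, |b s i - b s j| ≤ N s) (hσ : ∀ s i, N (σ i s) ≤ r * N s)
    (hb : ∀ s i, b (σ i s) i = b s i) (hb' : ∀ s i j, b (σ i s) j = b (σ j s) i) :
    ∃ u : S → C(SG q, ℝ), (∀ s i x, u s (cell q i x) = u (σ i s) x) ∧
      ∀ s i, u s (corner q i) = b s i := by
  have hN0 : ∀ s, 0 ≤ N s := fun s => (abs_nonneg _).trans (hN s 0 0)
  let W := {u : S → C(SG q, ℝ) // ∀ s i, u s (corner q i) = b s i}
  have hstep : ∀ u : W, ∃ u' : W, ∀ s i x, u'.1 s (cell q i x) = u.1 (σ i s) x := by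
    intro u
    choose v hv using fun s => exists_glue hq (fun i => u.1 (σ i s)) (fun i j => by
      rw [u.2, u.2, hb'])
    refine ⟨⟨v, fun s i => ?_⟩, hv⟩
    rw [← cell_corner_self, hv, u.2, hb]
  choose step hstep using hstep
  let u0 : W := ⟨fun s => ⟨fun x => ∑ k, b s k * bary q k x, by
      have := continuous_bary q
      fun_prop⟩, fun s i => by simp [bary_corner hq]⟩
  have hu0 : ∀ s i x, |u0.1 s x - b s i| ≤ N s := by
    intro s i x
    have h1 : u0.1 s x - b s i = ∑ k, (b s k - b s i) * bary q k x := by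
      simp only [sub_mul, Finset.sum_sub_distrib, ← Finset.mul_sum, sum_bary, mul_one]
      rfl
    rw [h1]
    calc |∑ k, (b s k - b s i) * bary q k x| ≤ ∑ k, |(b s k - b s i) * bary q k x| :=
          Finset.abs_sum_le_sum_abs _ _
      _ ≤ ∑ k, N s * bary q k x := by
          gcongr with k
          rw [abs_mul, abs_of_nonneg (bary_nonneg hq k x)]
          exact mul_le_mul_of_nonneg_right (hN s k i) (bary_nonneg hq k x)
      _ = N s := by rw [← Finset.mul_sum, sum_bary, mul_one]
  -- The start is affine interpolation, within $N(s)$ of each boundary value. A point of cell $i$ is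
  -- compared through the value at $q_i$, which $s$ and $\sigma_i s$ share; this gives the factor
  -- $2$.
  have hdiff : ∀ m s x, |(step^[m + 1] u0).1 s x - (step^[m] u0).1 s x| ≤ 2 * N s * r ^ m := by
    intro m
    induction m with
    | zero =>
      intro s x
      obtain ⟨i, y, rfl⟩ := cell_surjective q x
      simp only [zero_add, Function.iterate_one, Function.iterate_zero, id, pow_zero, mul_one]
      rw [hstep]
      have h1 := hu0 (σ i s) i y
      have h2 := hu0 s i (cell q i y)
      rw [hb] at h1
      have h3 := hσ s i
      have h4 := hN0 s
      rw [abs_le] at *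
      constructor <;> nlinarith
    | succ m ih =>
      intro s x
      obtain ⟨i, y, rfl⟩ := cell_surjective q x
      rw [Function.iterate_succ_apply' _ (m + 1), hstep]
      nth_rewrite 2 [Function.iterate_succ_apply']
      rw [hstep]
      refine (ih (σ i s) y).trans ?_
      have := hσ s i
      rw [pow_succ']
      calc 2 * N (σ i s) * r ^ m ≤ 2 * (r * N s) * r ^ m := by gcongr
        _ = _ := by ring
  have hcau : ∀ s, CauchySeq fun m => (step^[m] u0).1 s := by
    intro s
    refine cauchySeq_of_le_geometric r (2 * N s) hr1 fun m => ?_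
    rw [dist_comm, ContinuousMap.dist_le (by have := hN0 s; positivity)]
    exact fun x => hdiff m s x
  choose u hu using fun s => cauchySeq_tendsto_of_complete (hcau s)
  have hev : ∀ s x, Tendsto (fun m => (step^[m] u0).1 s x) atTop (𝓝 (u s x)) := fun s x =>
    ((continuous_eval_const x).tendsto _).comp (hu s)
  refine ⟨u, fun s i x => ?_, fun s i => ?_⟩
  · refine tendsto_nhds_unique ((hev s (cell q i x)).comp (tendsto_add_atTop_nat 1)) ?_
    refine (hev (σ i s) x).congr fun m => ?_
    simp only [Function.comp]
    rw [Function.iterate_succ_apply', hstep]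
  · refine tendsto_nhds_unique (hev s _) ?_
    simp only [fun m => (step^[m] u0).2 s i]
    exact tendsto_const_nhds

/-! ### Density of the vertices, and restriction to cells. -/

theorem dense_vertices {q : Fin 3 → Plane} (hq : IsEquilateral q) :
    Dense {x : SG q | ∃ m, x ∈ vertices q m} :=
  (dense_junctions hq).mono fun _ h => h.1

/-- Indexing the vertices by words and corners lets later proofs go by induction on the word, with
the boundary data generalized. -/
theorem nonneg_of_nonneg_vertices {q : Fin 3 → Plane} (hq : IsEquilateral q) {u : C(SG q, ℝ)}
    (h : ∀ (w : List (Fin 3)) i, 0 ≤ u (cellWord q w (corner q i))) (x : SG q) : 0 ≤ u x := by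
  have hc : IsClosed {x : SG q | 0 ≤ u x} := isClosed_le continuous_const u.continuous
  refine hc.closure_subset_iff.2 ?_ (dense_vertices hq x)
  rintro x ⟨m, hx⟩
  obtain ⟨w, -, i, rfl⟩ := (mem_vertices q).1 hx
  exact h w i

theorem eq_of_eq_vertices {q : Fin 3 → Plane} (hq : IsEquilateral q) {u v : C(SG q, ℝ)}
    (h : ∀ (w : List (Fin 3)) i, u (cellWord q w (corner q i)) = v (cellWord q w (corner q i))) :
    u = v := by
  refine ContinuousMap.ext fun x => ?_
  have h1 := nonneg_of_nonneg_vertices hq (u := u - v) (fun w i => by simp [h]) x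
  have h2 := nonneg_of_nonneg_vertices hq (u := v - u) (fun w i => by simp [h]) x
  simp only [ContinuousMap.coe_sub, Pi.sub_apply] at h1 h2
  linarith

/-- The restriction of `f` to a cell, as a function on the gasket. -/
def restr (q : Fin 3 → Plane) (i : Fin 3) (f : C(SG q, ℝ)) : C(SG q, ℝ) :=
  f.comp ⟨cell q i, continuous_cell q i⟩

@[simp] theorem restr_apply (q : Fin 3 → Plane) (i : Fin 3) (f : C(SG q, ℝ)) (x : SG q) :
    restr q i f x = f (cell q i x) := rfl

theorem norm_restr_le (q : Fin 3 → Plane) (i : Fin 3) (f : C(SG q, ℝ)) :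
    ‖restr q i f‖ ≤ ‖f‖ :=
  (ContinuousMap.norm_le _ (norm_nonneg _)).2 fun x => f.norm_coe_le_norm (cell q i x)

/-! ### The Dirichlet problem -/

variable {q : Fin 3 → Plane}

/-- The source term at the junction `F_i q_j = F_j q_i`, for a functional `I` that represents
integration against the harmonic functions with boundary values `0` and `1`. -/
def source (I : C(SG q, ℝ) → Fin 3 → ℝ) (f : C(SG q, ℝ)) (i j : Fin 3) : ℝ :=
  (I (restr q i f) j + I (restr q j f) i) / 5

/-- The values on the corners of the cell `i` of the solution of `Δ u = f` with boundary
values `a`. -/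
def subdivide (I : C(SG q, ℝ) → Fin 3 → ℝ) (f : C(SG q, ℝ)) (a : Fin 3 → ℝ) (i k : Fin 3) : ℝ :=
  if k = i then a i else (a i + a k + ∑ l, a l) / 5
    - ((source I f 0 1 + source I f 0 2 + source I f 1 2) / 2 + source I f i k) / 5

theorem source_comm (I : C(SG q, ℝ) → Fin 3 → ℝ) (f : C(SG q, ℝ)) (i j : Fin 3) :
    source I f i j = source I f j i := by
  rw [source, source, add_comm]

theorem abs_source_le {I : C(SG q, ℝ) → Fin 3 → ℝ} (hI : ∀ f j, |I f j| ≤ ‖f‖) (f : C(SG q, ℝ))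
    (i j : Fin 3) : |source I f i j| ≤ 2 / 5 * ‖f‖ := by
  have h1 := (hI (restr q i f) j).trans (norm_restr_le q i f)
  have h2 := (hI (restr q j f) i).trans (norm_restr_le q j f)
  rw [source]
  rw [abs_le] at *
  constructor <;> linarith

/-- The state is the pair $(f,a)$, and passing to a cell replaces $f$ by $\frac15 f\circ F_i$. The
functional `I` is left abstract to avoid a circle: $I=0$ gives the harmonic functions, integration
against these gives `harmInt`, and `harmInt` gives `poisson`. -/
theorem exists_subdivision_solution (hq : IsEquilateral q) {I : C(SG q, ℝ) → Fin 3 → ℝ}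
    (hI : ∀ f j, |I f j| ≤ ‖f‖) :
    ∃ u : C(SG q, ℝ) → (Fin 3 → ℝ) → C(SG q, ℝ),
      (∀ f a i x, u f a (cell q i x)
        = u ((1 / 5 : ℝ) • restr q i f) (subdivide I f a i) x) ∧
      ∀ f a i, u f a (corner q i) = a i := by
  have hosc : ∀ (a : Fin 3 → ℝ) i j, |a i - a j| ≤ ‖fun i j => a i - a j‖ := fun a i j =>
    (norm_le_pi_norm (fun j => a i - a j) j).trans
      (norm_le_pi_norm (fun i j => a i - a j) i)
  -- The size is the oscillation of $a$ plus $\|f\|$. The harmonic rule contracts oscillation by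
  -- $3/5$, the sources add at most $\frac25\|f\|$, and the new right-hand side has norm at most
  -- $\frac15\|f\|$; hence the ratio $3/5$.
  have key := exists_of_subdivision hq (S := C(SG q, ℝ) × (Fin 3 → ℝ))
    (fun s => s.2) (fun i s => ((1 / 5 : ℝ) • restr q i s.1, subdivide I s.1 s.2 i))
    (fun s => ‖fun i j => s.2 i - s.2 j‖ + ‖s.1‖) (r := 3 / 5) (by norm_num) (by norm_num)
    (fun s i j => (hosc s.2 i j).trans (le_add_of_nonneg_right (norm_nonneg _)))
  refine (key ?_ ?_ ?_).elim fun u hu =>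
    ⟨fun f a => u (f, a), fun f a i x => hu.1 (f, a) i x, fun f a i => hu.2 (f, a) i⟩
  · rintro ⟨f, a⟩ i
    have h1 : ‖(1 / 5 : ℝ) • restr q i f‖ ≤ 1 / 5 * ‖f‖ := by
      rw [norm_smul]
      have := norm_restr_le q i f
      norm_num
      linarith
    have h2 : ‖fun j k => subdivide I f a i j - subdivide I f a i k‖
        ≤ 3 / 5 * ‖fun i j => a i - a j‖ + 2 / 5 * ‖f‖ := by
      have ha := hosc a
      have h01 := abs_le.1 (ha 0 1)
      have h02 := abs_le.1 (ha 0 2)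
      have h12 := abs_le.1 (ha 1 2)
      have s01 := abs_le.1 (abs_source_le hI f 0 1)
      have s02 := abs_le.1 (abs_source_le hI f 0 2)
      have s12 := abs_le.1 (abs_source_le hI f 1 2)
      have e01 := source_comm I f 1 0
      have e02 := source_comm I f 2 0
      have e12 := source_comm I f 2 1
      have hnn : 0 ≤ 3 / 5 * ‖fun i j => a i - a j‖ + 2 / 5 * ‖f‖ := by positivity
      refine (pi_norm_le_iff_of_nonneg hnn).2 fun j => (pi_norm_le_iff_of_nonneg hnn).2 fun k => ?_
      rw [Real.norm_eq_abs, abs_le]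
      fin_cases i <;> fin_cases j <;> fin_cases k <;>
        simp [subdivide, Fin.sum_univ_three, e01, e02, e12] <;>
        first | positivity | (constructor <;> linarith)
    linarith
  · rintro ⟨f, a⟩ i
    simp [subdivide]
  · rintro ⟨f, a⟩ i j
    simp only [subdivide]
    rw [source_comm I f i j, add_comm (a i)]
    rcases eq_or_ne i j with rfl | hij
    · rfl
    · rw [if_neg hij, if_neg hij.symm]

/-! ### Harmonic functions -/

/-- The harmonic function with boundary values `a`. -/
def harm (hq : IsEquilateral q) (a : Fin 3 → ℝ) : C(SG q, ℝ) :=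
  (exists_subdivision_solution hq (I := fun _ _ => 0) (by simp)).choose 0 a

/-- The `1/5`-`2/5` rule. -/
def harmRule (a : Fin 3 → ℝ) (i k : Fin 3) : ℝ :=
  if k = i then a i else (a i + a k + ∑ l, a l) / 5

theorem harm_corner (hq : IsEquilateral q) (a : Fin 3 → ℝ) (i : Fin 3) :
    harm hq a (corner q i) = a i :=
  (exists_subdivision_solution hq (I := fun _ _ => 0) (by simp)).choose_spec.2 0 a i

theorem harm_cell (hq : IsEquilateral q) (a : Fin 3 → ℝ) (i : Fin 3) (x : SG q) :
    harm hq a (cell q i x) = harm hq (harmRule a i) x := by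
  have h := (exists_subdivision_solution hq (I := fun _ _ => 0) (by simp)).choose_spec.1 0 a i x
  have h1 : (1 / 5 : ℝ) • restr q i (0 : C(SG q, ℝ)) = 0 := by ext; simp
  have h2 : subdivide (fun (_ : C(SG q, ℝ)) (_ : Fin 3) => 0) 0 a i = harmRule a i := by
    funext k
    simp [subdivide, harmRule, source]
  rw [h1, h2] at h
  exact h

theorem harm_add (hq : IsEquilateral q) (a b : Fin 3 → ℝ) :
    harm hq (a + b) = harm hq a + harm hq b := by
  refine eq_of_eq_vertices hq fun w i => ?_
  induction w generalizing a b with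
  | nil => simp [cellWord, harm_corner]
  | cons j w ih =>
    have h : harmRule (a + b) j = harmRule a j + harmRule b j := by
      funext k
      simp only [harmRule, Pi.add_apply, Finset.sum_add_distrib]
      split_ifs
      · rfl
      · ring
    have := ih (harmRule a j) (harmRule b j)
    simp only [cellWord, ContinuousMap.add_apply, harm_cell] at this ⊢
    rw [h, this]

theorem harm_smul (hq : IsEquilateral q) (c : ℝ) (a : Fin 3 → ℝ) :
    harm hq (c • a) = c • harm hq a := by
  refine eq_of_eq_vertices hq fun w i => ?_
  induction w generalizing a with
  | nil => simp [cellWord, harm_corner]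
  | cons j w ih =>
    have h : harmRule (c • a) j = c • harmRule a j := by
      funext k
      simp only [harmRule, Pi.smul_apply, smul_eq_mul, ← Finset.mul_sum]
      split_ifs
      · rfl
      · ring
    have := ih (harmRule a j)
    simp only [cellWord, ContinuousMap.smul_apply, harm_cell] at this ⊢
    rw [h, this]

theorem harm_nonneg (hq : IsEquilateral q) {a : Fin 3 → ℝ} (ha : ∀ i, 0 ≤ a i) (x : SG q) :
    0 ≤ harm hq a x := by
  refine nonneg_of_nonneg_vertices hq (fun w i => ?_) x
  induction w generalizing a with
  | nil => simpa [cellWord, harm_corner] using ha i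
  | cons j w ih =>
    simp only [cellWord, harm_cell]
    refine ih fun k => ?_
    have := Finset.sum_nonneg fun i (_ : i ∈ Finset.univ) => ha i
    have := ha j
    have := ha k
    rw [harmRule]
    split_ifs <;> positivity

theorem harm_const (hq : IsEquilateral q) (c : ℝ) (x : SG q) : harm hq (fun _ => c) x = c := by
  have h : harm hq (fun _ => c) = ContinuousMap.const _ c := by
    refine eq_of_eq_vertices hq fun w i => ?_
    induction w with
    | nil => simp [cellWord, harm_corner]
    | cons j w ih =>
      have h : harmRule (fun _ => c) j = fun _ => c := by
        funext k
        simp only [harmRule, Fin.sum_univ_three]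
        split_ifs
        · rfl
        · ring
      simpa only [cellWord, harm_cell, h, ContinuousMap.const_apply] using ih
  rw [h]
  rfl

theorem harm_eq_sum (hq : IsEquilateral q) (a : Fin 3 → ℝ) :
    harm hq a = ∑ k, a k • harm hq (Pi.single k 1) := by
  have h : a = a 0 • (Pi.single 0 1 : Fin 3 → ℝ) + a 1 • (Pi.single 1 1 : Fin 3 → ℝ)
      + a 2 • (Pi.single 2 1 : Fin 3 → ℝ) := by
    funext k
    fin_cases k <;> simp
  conv_lhs => rw [h]
  rw [harm_add, harm_add, harm_smul, harm_smul, harm_smul, Fin.sum_univ_three]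

/-! ### The self-similar measure -/

/-- The uniform measure on letters. -/
abbrev letterMeasure : Measure (Fin 3) := (PMF.uniformOfFintype (Fin 3)).toMeasure

/-- The law of a sequence of independent uniform letters. -/
abbrev wordMeasure : Measure (ℕ → Fin 3) := Measure.infinitePi fun _ : ℕ => letterMeasure

theorem letterMeasure_singleton (i : Fin 3) : letterMeasure {i} = 3⁻¹ := by
  rw [PMF.toMeasure_apply_singleton _ _ (measurableSet_singleton i)]
  simp

/-- Prefixing a letter to an infinite word. -/
def prefixLetter (i : Fin 3) (w : ℕ → Fin 3) : ℕ → Fin 3 := fun k => Nat.casesOn k i w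

theorem measurable_prefixLetter :
    Measurable fun p : Fin 3 × (ℕ → Fin 3) => prefixLetter p.1 p.2 := by
  refine measurable_pi_lambda _ fun k => ?_
  cases k with
  | zero => exact measurable_fst
  | succ k => exact (measurable_pi_apply k).comp measurable_snd

/-- A product law is determined by its cylinders, and on these the prefixed letter splits off as an
independent coordinate. This is the self-similarity of `mu` on the level of addresses. -/
theorem map_prefixLetter :
    (letterMeasure.prod wordMeasure).map (fun p => prefixLetter p.1 p.2) = wordMeasure := by
  refine Measure.eq_infinitePi _ fun s t ht => ?_
  obtain ⟨n, hn⟩ := s.exists_nat_subset_range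
  have hs : s ⊆ Finset.range (n + 1) := hn.trans (Finset.range_mono n.le_succ)
  -- Unconstrained coordinates are filled in, so that the cylinder lives on an initial segment
  -- containing $0$.
  set t' : ℕ → Set (Fin 3) := fun i => if i ∈ s then t i else Set.univ with ht'
  have h1 : Set.pi (s : Set ℕ) t = Set.pi (Finset.range (n + 1) : Finset ℕ) t' := by
    ext w
    simp only [Set.mem_pi, Finset.mem_coe, ht']
    constructor
    · intro h i _
      split_ifs with h2
      · exact h i h2
      · trivial
    · intro h i hi
      have := h i (hs hi)
      rwa [if_pos hi] at this
  have h2 : ∏ i ∈ s, letterMeasure (t i) = ∏ i ∈ Finset.range (n + 1), letterMeasure (t' i) := by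
    rw [← Finset.prod_subset hs (fun i _ hi => by simp [ht', hi])]
    exact Finset.prod_congr rfl fun i hi => by simp [ht', hi]
  have h3 : (fun p : Fin 3 × (ℕ → Fin 3) => prefixLetter p.1 p.2) ⁻¹'
      Set.pi (Finset.range (n + 1) : Finset ℕ) t'
      = t' 0 ×ˢ Set.pi (Finset.range n : Finset ℕ) fun i => t' (i + 1) := by
    ext ⟨i, w⟩
    simp only [Set.mem_preimage, Set.mem_pi, Finset.mem_coe, Finset.mem_range, Set.mem_prod]
    constructor
    · exact fun h => ⟨h 0 n.succ_pos, fun k hk => h (k + 1) (by omega)⟩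
    · rintro ⟨h0, h⟩ (_ | k) hk
      · exact h0
      · exact h k (by omega)
  rw [h1, h2, Measure.map_apply measurable_prefixLetter
    (MeasurableSet.pi (Finset.countable_toSet _) fun i _ => MeasurableSet.of_discrete), h3,
    Measure.prod_prod, Measure.infinitePi_pi _ (fun i _ => MeasurableSet.of_discrete),
    Finset.prod_range_succ', mul_comm]

theorem integrable_continuousMap (f : C(SG q, ℝ)) : Integrable f (mu q) :=
  f.continuous.integrable_of_hasCompactSupport (HasCompactSupport.of_compactSpace f)

theorem integral_mu (f : C(SG q, ℝ)) : ∫ x, f x ∂(mu q) = ∫ w, f (addressSG q w) ∂wordMeasure :=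
  integral_map (measurable_addressSG q).aemeasurable f.continuous.aestronglyMeasurable

/-- The self-similarity of the measure, in terms of integrals. -/
theorem integral_eq_sum_restr (f : C(SG q, ℝ)) :
    ∫ x, f x ∂(mu q) = (1 / 3 : ℝ) * ∑ i, ∫ x, restr q i f x ∂(mu q) := by
  have hf : Measurable fun w => f (addressSG q w) :=
    f.continuous.measurable.comp (measurable_addressSG q)
  have hb : ∀ w, ‖f (addressSG q w)‖ ≤ ‖f‖ := fun w => f.norm_coe_le_norm _
  rw [integral_mu]
  conv_lhs => rw [← map_prefixLetter]
  rw [integral_map measurable_prefixLetter.aemeasurable hf.aestronglyMeasurable, integral_prod]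
  · have h : ∀ i : Fin 3, ∫ w, f (addressSG q (prefixLetter i w)) ∂wordMeasure
        = ∫ x, restr q i f x ∂(mu q) := by
      intro i
      rw [integral_mu]
      refine integral_congr_ae (Eventually.of_forall fun w => ?_)
      have h1 : addressSG q (prefixLetter i w) = cell q i (addressSG q w) :=
        Subtype.ext (contraction_address q i w).symm
      exact congrArg f h1
    simp only [h]
    rw [PMF.integral_eq_sum]
    simp [Finset.mul_sum]
  · exact Integrable.of_bound (hf.comp measurable_prefixLetter).aestronglyMeasurable ‖f‖
      (Eventually.of_forall fun p => hb _)

/-- A nonempty open set contains a cylinder of addresses, a finite product of positive masses. Full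
support makes $C(SG)\to L^2(SG)$ injective. -/
instance instIsOpenPosMeasureMu : (mu q).IsOpenPosMeasure := by
  refine ⟨fun U hU ⟨x, hx⟩ h0 => ?_⟩
  obtain ⟨_, w, rfl⟩ := x
  have hc : Continuous (addressSG q) := (continuous_address q).subtype_mk _
  rw [mu, Measure.map_apply (measurable_addressSG q) hU.measurableSet] at h0
  obtain ⟨s, t, ht, hst⟩ := isOpen_pi_iff.1 (hU.preimage hc) w hx
  have h1 := measure_mono_null hst h0
  rw [Measure.infinitePi_pi _ (fun i _ => MeasurableSet.of_discrete),
    Finset.prod_eq_zero_iff] at h1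
  obtain ⟨i, hi, h2⟩ := h1
  have h3 := measure_mono_null (Set.singleton_subset_iff.2 (ht i hi).2) h2
  rw [letterMeasure_singleton] at h3
  simp at h3

/-! ### Integration against harmonic functions -/

/-- The integral of `f` against the harmonic function with boundary values `δ_j`. -/
def harmInt (hq : IsEquilateral q) (f : C(SG q, ℝ)) (j : Fin 3) : ℝ :=
  ∫ x, f x * harm hq (Pi.single j 1) x ∂(mu q)

theorem integral_mul_harm (hq : IsEquilateral q) (f : C(SG q, ℝ)) (a : Fin 3 → ℝ) :
    ∫ x, f x * harm hq a x ∂(mu q) = ∑ k, a k * harmInt hq f k := by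
  have h : ∀ x, f x * harm hq a x = ∑ k, a k * (f x * harm hq (Pi.single k 1) x) := by
    intro x
    rw [harm_eq_sum]
    simp only [ContinuousMap.coe_sum, ContinuousMap.coe_smul, Finset.sum_apply, Pi.smul_apply,
      smul_eq_mul, Finset.mul_sum]
    exact Finset.sum_congr rfl fun k _ => by ring
  simp only [h]
  rw [integral_finsetSum _ fun k _ => ?_]
  · simp only [integral_const_mul]
    rfl
  · exact (integrable_continuousMap (f * harm hq (Pi.single k 1))).const_mul (a k)

theorem harmInt_eq_sum (hq : IsEquilateral q) (f : C(SG q, ℝ)) (j : Fin 3) :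
    harmInt hq f j = (1 / 3 : ℝ) * ∑ i, ∑ k, harmRule (Pi.single j 1) i k *
      harmInt hq (restr q i f) k := by
  have h := integral_eq_sum_restr (f * harm hq (Pi.single j 1))
  simp only [restr_apply, ContinuousMap.mul_apply, harm_cell] at h
  rw [harmInt, h]
  congr 1
  exact Finset.sum_congr rfl fun i _ => integral_mul_harm hq (restr q i f) _

theorem sum_harmInt (hq : IsEquilateral q) (f : C(SG q, ℝ)) :
    ∑ j, harmInt hq f j = ∫ x, f x ∂(mu q) := by
  have h := integral_mul_harm hq f fun _ => 1
  simpa [harm_const] using h.symm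

/-- No symmetry is needed: the three integrals have sum $1$, and the self-similar recursion then
determines each of them. -/
theorem harmInt_one (hq : IsEquilateral q) (j : Fin 3) : harmInt hq 1 j = 1 / 3 := by
  have h := sum_harmInt hq (1 : C(SG q, ℝ))
  have hr : ∀ i, restr q i (1 : C(SG q, ℝ)) = 1 := fun i => rfl
  have h1 := harmInt_eq_sum hq (1 : C(SG q, ℝ)) j
  simp [Fin.sum_univ_three] at h
  simp only [hr, Fin.sum_univ_three, harmRule] at h1
  fin_cases j <;> simp at h1 ⊢ <;> linarith

theorem harmInt_smul (hq : IsEquilateral q) (c : ℝ) (f : C(SG q, ℝ)) (j : Fin 3) :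
    harmInt hq (c • f) j = c * harmInt hq f j := by
  simp only [harmInt, ContinuousMap.coe_smul, Pi.smul_apply, smul_eq_mul, mul_assoc,
    integral_const_mul]

theorem harmInt_add (hq : IsEquilateral q) (f g : C(SG q, ℝ)) (j : Fin 3) :
    harmInt hq (f + g) j = harmInt hq f j + harmInt hq g j := by
  simp only [harmInt, ContinuousMap.coe_add, Pi.add_apply, add_mul]
  exact integral_add (integrable_continuousMap (f * harm hq (Pi.single j 1)))
    (integrable_continuousMap (g * harm hq (Pi.single j 1)))

theorem harmInt_le (hq : IsEquilateral q) {f : C(SG q, ℝ)} {c : ℝ} (h : ∀ x, |f x| ≤ c)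
    (j : Fin 3) : |harmInt hq f j| ≤ c / 3 := by
  have h0 : ∀ x, 0 ≤ harm hq (Pi.single j 1) x := fun x =>
    harm_nonneg hq (fun i => by rw [Pi.single_apply]; split_ifs <;> norm_num) x
  calc |harmInt hq f j| ≤ ∫ x, c * harm hq (Pi.single j 1) x ∂(mu q) := by
        rw [harmInt, ← Real.norm_eq_abs]
        refine norm_integral_le_of_norm_le
          ((integrable_continuousMap (harm hq (Pi.single j 1))).const_mul c)
          (Eventually.of_forall fun x => ?_)
        rw [Real.norm_eq_abs, abs_mul, abs_of_nonneg (h0 x)]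
        exact mul_le_mul_of_nonneg_right (h x) (h0 x)
    _ = c / 3 := by
        have h1 := harmInt_one hq j
        simp only [harmInt, ContinuousMap.one_apply, one_mul] at h1
        rw [integral_const_mul, h1]
        ring

theorem abs_harmInt_le_norm (hq : IsEquilateral q) (f : C(SG q, ℝ)) (j : Fin 3) :
    |harmInt hq f j| ≤ ‖f‖ :=
  (harmInt_le hq (fun x => f.norm_coe_le_norm x) j).trans (by have := norm_nonneg f; linarith)

/-- The integral against a harmonic function of boundary values `δ_j` of a nearly constant
function. -/
theorem abs_harmInt_sub_le (hq : IsEquilateral q) {f : C(SG q, ℝ)} {c ε : ℝ}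
    (h : ∀ x, |f x - c| ≤ ε) (j : Fin 3) : |harmInt hq f j - c / 3| ≤ ε / 3 := by
  have h1 := harmInt_le hq (f := f + (-c) • 1) (c := ε) (fun x => by
    simpa [sub_eq_add_neg] using h x) j
  rw [harmInt_add, harmInt_smul, harmInt_one] at h1
  convert h1 using 2
  ring

/-! ### The Dirichlet problem with a source, and its normal derivatives. -/

/-- The solution of `Δ u = f` with boundary values `a`. -/
def poisson (hq : IsEquilateral q) : C(SG q, ℝ) → (Fin 3 → ℝ) → C(SG q, ℝ) :=
  (exists_subdivision_solution hq (abs_harmInt_le_norm hq)).choose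

theorem poisson_cell (hq : IsEquilateral q) (f : C(SG q, ℝ)) (a : Fin 3 → ℝ) (i : Fin 3)
    (x : SG q) : poisson hq f a (cell q i x)
      = poisson hq ((1 / 5 : ℝ) • restr q i f) (subdivide (harmInt hq) f a i) x :=
  (exists_subdivision_solution hq (abs_harmInt_le_norm hq)).choose_spec.1 f a i x

theorem poisson_corner (hq : IsEquilateral q) (f : C(SG q, ℝ)) (a : Fin 3 → ℝ) (i : Fin 3) :
    poisson hq f a (corner q i) = a i :=
  (exists_subdivision_solution hq (abs_harmInt_le_norm hq)).choose_spec.2 f a i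

/-- The normal derivative at `q_j` of the solution of `Δ u = f` with boundary values `a`. -/
def flux (hq : IsEquilateral q) (f : C(SG q, ℝ)) (a : Fin 3 → ℝ) (j : Fin 3) : ℝ :=
  3 * a j - ∑ k, a k + harmInt hq f j

theorem flux_subdivide_self (hq : IsEquilateral q) (f : C(SG q, ℝ)) (a : Fin 3 → ℝ) (j : Fin 3) :
    flux hq ((1 / 5 : ℝ) • restr q j f) (subdivide (harmInt hq) f a j) j
      = 3 / 5 * flux hq f a j := by
  have h := harmInt_eq_sum hq f j
  simp only [flux, harmInt_smul]
  rw [h]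
  fin_cases j <;> simp [Fin.sum_univ_three, harmRule, subdivide, source] <;> ring

/-- The three matching conditions at the level-one junctions form a linear system for the junction
values, and `subdivide` is its solution. -/
theorem flux_subdivide_add (hq : IsEquilateral q) (f : C(SG q, ℝ)) (a : Fin 3 → ℝ) {i j : Fin 3}
    (hij : i ≠ j) :
    flux hq ((1 / 5 : ℝ) • restr q i f) (subdivide (harmInt hq) f a i) j
      + flux hq ((1 / 5 : ℝ) • restr q j f) (subdivide (harmInt hq) f a j) i = 0 := by
  simp only [flux, harmInt_smul]
  fin_cases i <;> fin_cases j <;> first | exact absurd rfl hij | skip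
  all_goals
    simp [Fin.sum_univ_three, subdivide, source]
    ring

/-! ### Graph Laplacians -/

theorem graph_adj_succ {m : ℕ} {x y : SG q} :
    (graph q (m + 1)).Adj x y ↔
      ∃ i x' y', x = cell q i x' ∧ y = cell q i y' ∧ (graph q m).Adj x' y' := by
  constructor
  · rintro ⟨hne, w, hw, i, j, rfl, rfl⟩
    obtain ⟨l, w, rfl⟩ := List.exists_cons_of_length_eq_add_one hw
    exact ⟨l, _, _, rfl, rfl, fun h => hne (congrArg (cell q l) h), w, by simpa using hw, i, j,
      rfl, rfl⟩
  · rintro ⟨l, x', y', rfl, rfl, hne, w, hw, i, j, rfl, rfl⟩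
    exact ⟨fun h => hne (cell_injective q l h), l :: w, by simp [hw], i, j, rfl, rfl⟩

open Classical in
/-- The neighbours of a point in the graph of level `m`. -/
def neighbors (q : Fin 3 → Plane) (m : ℕ) (x : SG q) : Finset (SG q) :=
  (vertices q m).filter fun y => (graph q m).Adj x y

theorem mem_neighbors {m : ℕ} {x y : SG q} : y ∈ neighbors q m x ↔ (graph q m).Adj x y := by
  classical
  rw [neighbors, Finset.mem_filter, and_iff_right_iff_imp]
  rintro ⟨-, w, hw, i, j, -, rfl⟩
  exact (mem_vertices q).2 ⟨w, hw, j, rfl⟩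

theorem graphLaplacian_eq (m : ℕ) (u : SG q → ℝ) (x : SG q) :
    graphLaplacian q m u x = ∑ y ∈ neighbors q m x, (u y - u x) := rfl

/-- The hypothesis says that the point lies in no other level-one cell, so all its neighbours lie in
cell $i$. -/
theorem graphLaplacian_cell {m : ℕ} (u : SG q → ℝ) {i : Fin 3} {x : SG q}
    (h : ∀ j y, cell q i x = cell q j y → i = j) :
    graphLaplacian q (m + 1) u (cell q i x) = graphLaplacian q m (fun y => u (cell q i y)) x := by
  classical
  have h1 : neighbors q (m + 1) (cell q i x) = (neighbors q m x).image (cell q i) := by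
    ext y
    rw [mem_neighbors, Finset.mem_image, graph_adj_succ]
    constructor
    · rintro ⟨j, x', y', hx, rfl, hadj⟩
      obtain rfl := h j x' hx
      rw [← cell_injective q i hx] at hadj
      exact ⟨y', mem_neighbors.2 hadj, rfl⟩
    · rintro ⟨y', hy, rfl⟩
      exact ⟨i, x, y', rfl, rfl, mem_neighbors.1 hy⟩
  rw [graphLaplacian_eq, h1, Finset.sum_image fun _ _ _ _ hxy => cell_injective q i hxy]
  rfl

theorem graphLaplacian_cell_of_notMem (hq : IsEquilateral q) {m : ℕ} (u : SG q → ℝ) {x : SG q}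
    (hx : x ∉ vertices q 0) (i : Fin 3) :
    graphLaplacian q (m + 1) u (cell q i x) = graphLaplacian q m (fun y => u (cell q i y)) x := by
  refine graphLaplacian_cell u fun j y h => ?_
  by_contra hij
  exact hx ((mem_vertices_zero q).2 ⟨j, (eq_corner_of_cell_eq hq hij h).1⟩)

theorem graphLaplacian_corner_succ (hq : IsEquilateral q) {m : ℕ} (u : SG q → ℝ) (i : Fin 3) :
    graphLaplacian q (m + 1) u (corner q i)
      = graphLaplacian q m (fun y => u (cell q i y)) (corner q i) := by
  conv_lhs => rw [← cell_corner_self q i]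
  refine graphLaplacian_cell u fun j y h => ?_
  rw [cell_corner_self] at h
  exact (eq_corner_of_cell_eq_corner hq h.symm).1.symm

theorem graphLaplacian_corner_zero (hq : IsEquilateral q) (u : SG q → ℝ) (i : Fin 3) :
    graphLaplacian q 0 u (corner q i) = ∑ k, u (corner q k) - 3 * u (corner q i) := by
  classical
  have h1 : neighbors q 0 (corner q i) = (Finset.univ.erase i).image (corner q) := by
    ext y
    rw [mem_neighbors, Finset.mem_image]
    constructor
    · rintro ⟨hne, w, hw, i', j, hx, rfl⟩
      obtain rfl := List.length_eq_zero_iff.1 hw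
      refine ⟨j, Finset.mem_erase.2 ⟨?_, Finset.mem_univ j⟩, rfl⟩
      rintro rfl
      exact hne rfl
    · rintro ⟨j, hj, rfl⟩
      exact ⟨fun h => (Finset.ne_of_mem_erase hj).symm (corner_injective hq h), [], rfl, i, j, rfl,
        rfl⟩
  rw [graphLaplacian_eq, h1, Finset.sum_image fun _ _ _ _ hxy => corner_injective hq hxy,
    Finset.sum_erase _ (sub_self _), Finset.sum_sub_distrib]
  simp

theorem graphLaplacian_junction (hq : IsEquilateral q) (m : ℕ) (u : SG q → ℝ) {i j : Fin 3}
    (hij : i ≠ j) :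
    graphLaplacian q (m + 1) u (cell q i (corner q j))
      = graphLaplacian q m (fun y => u (cell q i y)) (corner q j)
        + graphLaplacian q m (fun y => u (cell q j y)) (corner q i) := by
  classical
  have h1 : neighbors q (m + 1) (cell q i (corner q j))
      = (neighbors q m (corner q j)).image (cell q i)
        ∪ (neighbors q m (corner q i)).image (cell q j) := by
    ext y
    rw [mem_neighbors, Finset.mem_union, Finset.mem_image, Finset.mem_image, graph_adj_succ]
    constructor
    · rintro ⟨l, x', y', hx, rfl, hadj⟩
      rcases eq_or_ne i l with rfl | hil
      · rw [← cell_injective q i hx] at hadj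
        exact Or.inl ⟨y', mem_neighbors.2 hadj, rfl⟩
      · obtain ⟨h2, rfl⟩ := eq_corner_of_cell_eq hq hil hx
        obtain rfl := corner_injective hq h2
        exact Or.inr ⟨y', mem_neighbors.2 hadj, rfl⟩
    · rintro (⟨y', hy, rfl⟩ | ⟨y', hy, rfl⟩)
      · exact ⟨i, _, y', rfl, rfl, mem_neighbors.1 hy⟩
      · exact ⟨j, _, y', cell_corner_comm q i j, rfl, mem_neighbors.1 hy⟩
  have h2 : Disjoint ((neighbors q m (corner q j)).image (cell q i))
      ((neighbors q m (corner q i)).image (cell q j)) := by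
    rw [Finset.disjoint_left]
    intro z hz hz'
    obtain ⟨y, hy, rfl⟩ := Finset.mem_image.1 hz
    obtain ⟨y', -, h⟩ := Finset.mem_image.1 hz'
    exact (mem_neighbors.1 hy).1 (eq_corner_of_cell_eq hq hij h.symm).1.symm
  rw [graphLaplacian_eq, h1, Finset.sum_union h2,
    Finset.sum_image fun _ _ _ _ hxy => cell_injective q i hxy,
    Finset.sum_image fun _ _ _ _ hxy => cell_injective q j hxy]
  rw [cell_corner_comm q i j, graphLaplacian_eq, ← cell_corner_comm q i j, graphLaplacian_eq,
    cell_corner_comm q i j]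

theorem graphLaplacian_add (m : ℕ) (u v : SG q → ℝ) (x : SG q) :
    graphLaplacian q m (u + v) x = graphLaplacian q m u x + graphLaplacian q m v x := by
  simp only [graphLaplacian_eq, Pi.add_apply, ← Finset.sum_add_distrib]
  exact Finset.sum_congr rfl fun y _ => by ring

theorem graphLaplacian_smul (m : ℕ) (c : ℝ) (u : SG q → ℝ) (x : SG q) :
    graphLaplacian q m (c • u) x = c * graphLaplacian q m u x := by
  simp only [graphLaplacian_eq, Pi.smul_apply, smul_eq_mul, Finset.mul_sum]
  exact Finset.sum_congr rfl fun y _ => by ring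

/-! ### The Laplacian of the solutions of the Dirichlet problem -/

theorem iterate_restr_apply (i : Fin 3) (m : ℕ) (f : C(SG q, ℝ)) (x : SG q) :
    (restr q i)^[m] f x = f ((cell q i)^[m] x) := by
  induction m generalizing f with
  | zero => rfl
  | succ m ih =>
    rw [Function.iterate_succ_apply, ih, restr_apply, Function.iterate_succ_apply']

theorem iterate_restr_smul (i : Fin 3) (m : ℕ) (c : ℝ) (f : C(SG q, ℝ)) :
    (restr q i)^[m] (c • f) = c • (restr q i)^[m] f := by
  ext x
  simp [iterate_restr_apply]

theorem poisson_comp_cell (hq : IsEquilateral q) (f : C(SG q, ℝ)) (a : Fin 3 → ℝ) (i : Fin 3) :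
    (fun y => poisson hq f a (cell q i y))
      = poisson hq ((1 / 5 : ℝ) • restr q i f) (subdivide (harmInt hq) f a i) :=
  funext fun y => poisson_cell hq f a i y

/-- At a boundary vertex the graph Laplacian is one-sided. It splits exactly into an integral term
of order $5^{-m}$, which carries $f$, and a normal-derivative term of order $(3/5)^m$, which must
cancel at junctions. -/
theorem graphLaplacian_poisson_corner (hq : IsEquilateral q) (m : ℕ) (f : C(SG q, ℝ))
    (a : Fin 3 → ℝ) (j : Fin 3) :
    graphLaplacian q m (poisson hq f a) (corner q j)
      = (1 / 5) ^ m * harmInt hq ((restr q j)^[m] f) j - (3 / 5) ^ m * flux hq f a j := by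
  induction m generalizing f a with
  | zero =>
    rw [graphLaplacian_corner_zero hq]
    simp only [poisson_corner, flux, Function.iterate_zero, id]
    ring
  | succ m ih =>
    rw [graphLaplacian_corner_succ hq, poisson_comp_cell, ih, flux_subdivide_self,
      iterate_restr_smul, harmInt_smul, Function.iterate_succ_apply]
    ring

/-- Peeling off the first letter leads either to the same claim for $\frac15 f\circ F_i$, with
$\varepsilon/5$, or to a level-one junction. There the fluxes cancel, and two integrals, each within
$\varepsilon/3$ of $f(x)/3$, remain; this is where the factor $\frac32$ comes from. -/
theorem graphLaplacian_poisson_sub_le (hq : IsEquilateral q) (m : ℕ) (f : C(SG q, ℝ))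
    (a : Fin 3 → ℝ) {ε : ℝ}
    (hε : ∀ w : List (Fin 3), w.length = m → ∀ y z,
      |f (cellWord q w y) - f (cellWord q w z)| ≤ ε)
    {x : SG q} (hx : x ∈ vertices q m) (hx0 : x ∉ vertices q 0) :
    |3 / 2 * 5 ^ m * graphLaplacian q m (poisson hq f a) x - f x| ≤ ε := by
  induction m generalizing f a x ε with
  | zero => exact absurd hx hx0
  | succ m ih =>
    obtain ⟨w, hw, l, rfl⟩ := (mem_vertices q).1 hx
    obtain ⟨i, w, rfl⟩ := List.exists_cons_of_length_eq_add_one hw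
    replace hw : w.length = m := by simpa using hw
    rw [cellWord] at hx0 ⊢
    have hy : cellWord q w (corner q l) ∈ vertices q m := (mem_vertices q).2 ⟨w, hw, l, rfl⟩
    generalize cellWord q w (corner q l) = y at hx hx0 hy ⊢
    by_cases hy0 : y ∈ vertices q 0
    · obtain ⟨j, rfl⟩ := (mem_vertices_zero q).1 hy0
      have hij : i ≠ j := by
        rintro rfl
        exact hx0 ((mem_vertices_zero q).2 ⟨i, cell_corner_self q i⟩)
      -- The point is a variable so that the bound applies to both names $F_iq_j=F_jq_i$ of the
      -- junction.
      have h1 : ∀ {i j : Fin 3} {y : SG q}, cell q i (corner q j) = y →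
          |harmInt hq ((restr q j)^[m] (restr q i f)) j - f y / 3| ≤ ε / 3 := by
        rintro i j _ rfl
        refine abs_harmInt_sub_le hq (fun x => ?_) j
        have h := hε (i :: List.replicate m j) (by simp) x (corner q j)
        rw [cellWord, cellWord, cellWord_replicate, cellWord_replicate,
          Function.iterate_fixed (cell_corner_self q j)] at h
        rwa [iterate_restr_apply]
      have h2 := h1 (rfl : cell q i (corner q j) = _)
      have h3 := h1 (cell_corner_comm q j i)
      have h4 := flux_subdivide_add hq f a hij
      rw [graphLaplacian_junction hq m _ hij, poisson_comp_cell, poisson_comp_cell,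
        graphLaplacian_poisson_corner, graphLaplacian_poisson_corner, iterate_restr_smul,
        iterate_restr_smul, harmInt_smul, harmInt_smul, eq_neg_of_add_eq_zero_left h4]
      have h5 : (5 : ℝ) ^ m * (1 / 5) ^ m = 1 := by rw [← mul_pow]; norm_num
      generalize harmInt hq ((restr q j)^[m] (restr q i f)) j = A at *
      generalize harmInt hq ((restr q i)^[m] (restr q j f)) i = B at *
      have h6 : ∀ F : ℝ, 3 / 2 * 5 ^ (m + 1) * ((1 / 5) ^ m * (1 / 5 * A) - (3 / 5) ^ m * -F
          + ((1 / 5) ^ m * (1 / 5 * B) - (3 / 5) ^ m * F)) = 3 / 2 * (A + B) := by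
        intro F
        rw [pow_succ]
        linear_combination (3 / 2 * (A + B)) * h5
      rw [h6]
      rw [abs_le] at *
      constructor <;> linarith
    · have h := ih ((1 / 5 : ℝ) • restr q i f) (subdivide (harmInt hq) f a i) (ε := ε / 5)
        (fun w hw y z => ?_) hy hy0
      · rw [graphLaplacian_cell_of_notMem hq _ hy0, poisson_comp_cell]
        simp only [ContinuousMap.coe_smul, Pi.smul_apply, smul_eq_mul, restr_apply] at h
        rw [pow_succ, abs_le] at *
        constructor <;> linarith
      · have h := hε (i :: w) (by simp [hw]) y z
        simp only [cellWord] at h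
        simp only [ContinuousMap.coe_smul, Pi.smul_apply, smul_eq_mul, restr_apply]
        rw [abs_le] at *
        constructor <;> linarith

theorem exists_oscillation_le (f : C(SG q, ℝ)) {ε : ℝ} (hε : 0 < ε) :
    ∃ M : ℕ, ∀ m, M ≤ m → ∀ w : List (Fin 3), w.length = m → ∀ y z,
      |f (cellWord q w y) - f (cellWord q w z)| ≤ ε := by
  obtain ⟨δ, hδ, hf⟩ := Metric.uniformContinuous_iff.1
    (CompactSpace.uniformContinuous_of_continuous f.continuous) ε hε
  obtain ⟨D, hD⟩ := Metric.isBounded_iff.1 (isCompact_univ (X := SG q)).isBounded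
  have h1 : Tendsto (fun m : ℕ => D / 2 ^ m) atTop (𝓝 0) := by
    have := (tendsto_pow_atTop_nhds_zero_of_lt_one (r := (1 / 2 : ℝ)) (by norm_num)
      (by norm_num)).const_mul D
    simpa [div_eq_mul_inv] using this
  obtain ⟨M, hM⟩ := eventually_atTop.1 (h1.eventually (gt_mem_nhds hδ))
  refine ⟨M, fun m hm w hw y z => ?_⟩
  rw [← Real.dist_eq]
  refine (hf ?_).le
  rw [dist_cellWord, hw]
  refine lt_of_le_of_lt ?_ (hM m hm)
  gcongr
  exact hD (Set.mem_univ _) (Set.mem_univ _)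

theorem hasLaplacian_poisson (hq : IsEquilateral q) (f : C(SG q, ℝ)) (a : Fin 3 → ℝ) :
    HasLaplacian q (poisson hq f a) f := by
  intro ε hε
  obtain ⟨M, hM⟩ := exists_oscillation_le f (half_pos hε)
  refine ⟨M, fun m hm x hx hx0 => ?_⟩
  exact (graphLaplacian_poisson_sub_le hq m f a (hM m hm) hx hx0).trans_lt (half_lt_self hε)

/-! ### Calculus of the Laplacian -/

theorem HasLaplacian.add {u v f g : C(SG q, ℝ)} (hu : HasLaplacian q u f)
    (hv : HasLaplacian q v g) : HasLaplacian q (u + v) (f + g) := by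
  intro ε hε
  obtain ⟨M, hM⟩ := hu (ε / 2) (half_pos hε)
  obtain ⟨N, hN⟩ := hv (ε / 2) (half_pos hε)
  refine ⟨max M N, fun m hm x hx hx0 => ?_⟩
  have h1 := hM m (le_of_max_le_left hm) x hx hx0
  have h2 := hN m (le_of_max_le_right hm) x hx hx0
  rw [ContinuousMap.coe_add, graphLaplacian_add, ContinuousMap.add_apply]
  rw [abs_lt] at *
  constructor <;> linarith

theorem HasLaplacian.smul {u f : C(SG q, ℝ)} (hu : HasLaplacian q u f) (c : ℝ) :
    HasLaplacian q (c • u) (c • f) := by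
  intro ε hε
  have hc : 0 < |c| + 1 := by positivity
  obtain ⟨M, hM⟩ := hu (ε / (|c| + 1)) (div_pos hε hc)
  refine ⟨M, fun m hm x hx hx0 => ?_⟩
  have h1 := hM m hm x hx hx0
  rw [ContinuousMap.coe_smul, graphLaplacian_smul, ContinuousMap.smul_apply, smul_eq_mul,
    show 3 / 2 * 5 ^ m * (c * graphLaplacian q m u x) - c * f x
      = c * (3 / 2 * 5 ^ m * graphLaplacian q m u x - f x) by ring, abs_mul]
  calc |c| * |3 / 2 * 5 ^ m * graphLaplacian q m u x - f x|
      ≤ |c| * (ε / (|c| + 1)) := by gcongr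
    _ < (|c| + 1) * (ε / (|c| + 1)) := by
        have := div_pos hε hc
        nlinarith
    _ = ε := mul_div_cancel₀ _ hc.ne'

theorem hasLaplacian_zero : HasLaplacian q 0 0 := by
  intro ε hε
  refine ⟨0, fun m _ x _ _ => ?_⟩
  simpa [graphLaplacian_eq] using hε

theorem HasLaplacian.sub {u v f g : C(SG q, ℝ)} (hu : HasLaplacian q u f)
    (hv : HasLaplacian q v g) : HasLaplacian q (u - v) (f - g) := by
  have h := hu.add (hv.smul (-1))
  rwa [neg_one_smul, neg_one_smul, ← sub_eq_add_neg, ← sub_eq_add_neg] at h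

theorem HasLaplacian.sum {ι : Type*} (s : Finset ι) {u f : ι → C(SG q, ℝ)}
    (h : ∀ i ∈ s, HasLaplacian q (u i) (f i)) :
    HasLaplacian q (∑ i ∈ s, u i) (∑ i ∈ s, f i) := by
  classical
  induction s using Finset.induction_on with
  | empty => simpa using hasLaplacian_zero
  | insert i s hi ih =>
    rw [Finset.sum_insert hi, Finset.sum_insert hi]
    exact (h i (Finset.mem_insert_self i s)).add
      (ih fun j hj => h j (Finset.mem_insert_of_mem hj))

theorem HasLaplacian.restr (hq : IsEquilateral q) {u f : C(SG q, ℝ)} (hu : HasLaplacian q u f)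
    (i : Fin 3) :
    HasLaplacian q (SierpinskiGasket.restr q i u)
      ((1 / 5 : ℝ) • SierpinskiGasket.restr q i f) := by
  intro ε hε
  obtain ⟨M, hM⟩ := hu ε hε
  refine ⟨M, fun m hm x hx hx0 => ?_⟩
  have h := hM (m + 1) (by omega) (cell q i x) (cell_mem_vertices q hx i)
    (cell_notMem_vertices_zero hq hx0 i)
  rw [graphLaplacian_cell_of_notMem hq _ hx0] at h
  rw [ContinuousMap.smul_apply, restr_apply, smul_eq_mul]
  change |3 / 2 * 5 ^ m * graphLaplacian q m (fun y => u (cell q i y)) x - _| < ε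
  rw [pow_succ, abs_lt] at *
  constructor <;> linarith

/-- A junction belongs to the vertex sets of all later levels, so the limit determines $f$ there;
junctions are dense. -/
theorem HasLaplacian.unique (hq : IsEquilateral q) {u f g : C(SG q, ℝ)} (hf : HasLaplacian q u f)
    (hg : HasLaplacian q u g) : f = g := by
  have h0 := hf.sub hg
  rw [sub_self] at h0
  have hc : IsClosed {x : SG q | (f - g) x = 0} :=
    isClosed_eq (f - g).continuous continuous_const
  refine ContinuousMap.ext fun x => sub_eq_zero.1
    (hc.closure_subset_iff.2 ?_ (dense_junctions hq x))
  rintro x ⟨⟨k, hk⟩, hx0⟩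
  refine abs_nonpos_iff.1 (le_of_forall_pos_lt_add fun ε hε => ?_)
  obtain ⟨M, hM⟩ := h0 ε hε
  have h := hM (max M k) (le_max_left _ _) x (vertices_mono q (le_max_right _ _) hk) hx0
  simpa [graphLaplacian_eq, abs_sub_comm] using h

/-- The maximum principle. -/
theorem HasLaplacian.nonpos (hq : IsEquilateral q) {u : C(SG q, ℝ)} (hu : HasLaplacian q u 0)
    (hb : ∀ i, u (corner q i) ≤ 0) (x : SG q) : u x ≤ 0 := by
  -- Strict perturbation: $w$ vanishes at the corners and $\Delta w=1$, so at high level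
  -- $u+\varepsilon w$ has positive graph Laplacian at every junction and takes its maximum over
  -- $V_m$ at a corner.
  set w := poisson hq 1 0 with hw
  have hwL : HasLaplacian q w 1 := hasLaplacian_poisson hq 1 0
  have key : ∀ k, ∀ z ∈ vertices q k, ∀ ε > 0, u z ≤ ε * ‖w‖ := by
    intro k z hz ε hε
    obtain ⟨M, hM⟩ := hu (ε / 2) (half_pos hε)
    obtain ⟨N, hN⟩ := hwL (1 / 2) (by norm_num)
    set m := max k (max M N)
    have hzm : z ∈ vertices q m := vertices_mono q (le_max_left _ _) hz
    obtain ⟨y, hy, hmax⟩ := (vertices q m).exists_max_image (fun y => (u + ε • w) y) ⟨z, hzm⟩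
    have hy0 : y ∈ vertices q 0 := by
      by_contra hy0
      have h1 := hM m ((le_max_left _ _).trans (le_max_right _ _)) y hy hy0
      have h2 := hN m ((le_max_right _ _).trans (le_max_right _ _)) y hy hy0
      have h3 : graphLaplacian q m (u + ε • w : C(SG q, ℝ)) y ≤ 0 := by
        classical
        refine Finset.sum_nonpos fun y' hy' => sub_nonpos.2 (hmax y' (Finset.mem_filter.1 hy').1)
      rw [ContinuousMap.coe_add, ContinuousMap.coe_smul, graphLaplacian_add,
        graphLaplacian_smul] at h3
      have h5 : (0 : ℝ) < 3 / 2 * 5 ^ m := by positivity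
      have h4 := mul_nonpos_of_nonneg_of_nonpos h5.le h3
      simp only [ContinuousMap.zero_apply, ContinuousMap.one_apply] at h1 h2
      rw [abs_lt] at h1 h2
      nlinarith [h1.1, h2.1]
    obtain ⟨i, rfl⟩ := (mem_vertices_zero q).1 hy0
    have h1 := hmax z hzm
    simp only [ContinuousMap.add_apply, ContinuousMap.smul_apply, smul_eq_mul] at h1
    have h2 : w (corner q i) = 0 := poisson_corner hq 1 0 i
    rw [h2] at h1
    have h3 := hb i
    have h4 := (abs_le.1 (w.norm_coe_le_norm z)).1
    nlinarith
  have h := nonneg_of_nonneg_vertices hq (u := -u) (fun w' i => ?_) x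
  · simpa using h
  · simp only [ContinuousMap.neg_apply, neg_nonneg]
    refine le_of_forall_pos_lt_add fun ε hε => ?_
    have h1 : 0 < ‖w‖ + 1 := by positivity
    have h2 := key _ _ ((mem_vertices q).2 ⟨w', rfl, i, rfl⟩) (ε / (‖w‖ + 1)) (div_pos hε h1)
    have h3 : ε / (‖w‖ + 1) * (‖w‖ + 1) = ε := div_mul_cancel₀ _ h1.ne'
    have h4 := div_pos hε h1
    linarith

/-- Harmonic functions are determined by their boundary values. -/
theorem HasLaplacian.eq_zero (hq : IsEquilateral q) {u : C(SG q, ℝ)} (hu : HasLaplacian q u 0)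
    (hb : ∀ i, u (corner q i) = 0) : u = 0 := by
  refine ContinuousMap.ext fun x => le_antisymm (hu.nonpos hq (fun i => (hb i).le) x) ?_
  have h := hu.smul (-1)
  rw [smul_zero] at h
  simpa using h.nonpos hq (fun i => by simp [hb]) x

/-! ### Symmetries of the gasket -/

/-- The affine map of the plane that permutes the vertices by `π`. -/
def permPoint (q : Fin 3 → Plane) (π : Equiv.Perm (Fin 3)) (x : Plane) : Plane :=
  ∑ k, bary q k x • q (π k)

theorem continuous_permPoint (q : Fin 3 → Plane) (π : Equiv.Perm (Fin 3)) :
    Continuous (permPoint q π) := by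
  have := continuous_bary q
  unfold permPoint
  fun_prop

theorem permPoint_contraction (hq : IsEquilateral q) (π : Equiv.Perm (Fin 3)) (i : Fin 3)
    (x : Plane) : permPoint q π (contraction q i x) = contraction q (π i) (permPoint q π x) := by
  have h3 : ∑ k, (if k = i then (1 : ℝ) else 0) • q (π k) = q (π i) := by simp
  simp only [permPoint, bary_contraction hq]
  simp only [contraction, add_smul, Finset.sum_add_distrib, div_eq_inv_mul _ (2 : ℝ),
    mul_smul, ← Finset.smul_sum, h3]
  module

theorem permPoint_address (hq : IsEquilateral q) (π : Equiv.Perm (Fin 3)) (w : ℕ → Fin 3) :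
    permPoint q π (address q w) = address q fun k => π (w k) := by
  have h := eq_zero_of_norm_le_half
    (f := fun w : ℕ → Fin 3 => permPoint q π (address q w) - address q fun k => π (w k))
    (by
      have h1 := continuous_permPoint q π
      have h2 := continuous_address q
      have h3 : Continuous π := continuous_of_discreteTopology
      fun_prop) (fun w => ?_) w
  · exact sub_eq_zero.1 h
  -- The defect of a word is half the defect of its shift.
  refine ⟨fun k => w (k + 1), le_of_eq ?_⟩
  have h1 : w = fun k => Nat.casesOn k (w 0) fun k => w (k + 1) := by
    funext k
    cases k <;> rfl
  have h2 : (fun k => π (w k)) = fun k => Nat.casesOn k (π (w 0)) fun k => π (w (k + 1)) := by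
    funext k
    cases k <;> rfl
  have h3 : permPoint q π (address q w) - address q (fun k => π (w k))
      = (1 / 2 : ℝ) • (permPoint q π (address q fun k => w (k + 1))
        - address q fun k => π (w (k + 1))) := by
    rw [h2, ← contraction_address]
    conv_lhs => rw [h1, ← contraction_address, permPoint_contraction hq]
    simp only [contraction]
    module
  rw [h3, norm_smul]
  norm_num
  ring

theorem permPoint_mem_SG (hq : IsEquilateral q) (π : Equiv.Perm (Fin 3)) {x : Plane}
    (hx : x ∈ SG q) : permPoint q π x ∈ SG q := by
  obtain ⟨w, rfl⟩ := hx
  exact ⟨_, (permPoint_address hq π w).symm⟩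

/-- The symmetry of the gasket that permutes the vertices by `π`. -/
def symmetry (hq : IsEquilateral q) (π : Equiv.Perm (Fin 3)) : C(SG q, SG q) :=
  ⟨fun x => ⟨permPoint q π x, permPoint_mem_SG hq π x.2⟩,
    ((continuous_permPoint q π).comp continuous_subtype_val).subtype_mk _⟩

theorem symmetry_addressSG (hq : IsEquilateral q) (π : Equiv.Perm (Fin 3)) (w : ℕ → Fin 3) :
    symmetry hq π (addressSG q w) = addressSG q fun k => π (w k) :=
  Subtype.ext (permPoint_address hq π w)

theorem symmetry_cell (hq : IsEquilateral q) (π : Equiv.Perm (Fin 3)) (i : Fin 3) (x : SG q) :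
    symmetry hq π (cell q i x) = cell q (π i) (symmetry hq π x) :=
  Subtype.ext (permPoint_contraction hq π i x)

theorem symmetry_corner (hq : IsEquilateral q) (π : Equiv.Perm (Fin 3)) (i : Fin 3) :
    symmetry hq π (corner q i) = corner q (π i) := by
  refine Subtype.ext ?_
  change permPoint q π (q i) = q (π i)
  simp [permPoint, bary_vertex hq]

theorem symmetry_symmetry_of_inverse (hq : IsEquilateral q) {π σ : Equiv.Perm (Fin 3)}
    (h : ∀ i, σ (π i) = i) (x : SG q) : symmetry hq σ (symmetry hq π x) = x := by
  obtain ⟨_, w, rfl⟩ := x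
  change symmetry hq σ (symmetry hq π (addressSG q w)) = addressSG q w
  simp only [symmetry_addressSG, h]

theorem symmetry_injective (hq : IsEquilateral q) (π : Equiv.Perm (Fin 3)) :
    Function.Injective (symmetry hq π) :=
  Function.LeftInverse.injective (g := symmetry hq π.symm) fun x =>
    symmetry_symmetry_of_inverse hq π.symm_apply_apply x

theorem symmetry_iterate_cell (hq : IsEquilateral q) (π : Equiv.Perm (Fin 3)) (i : Fin 3) (m : ℕ)
    (x : SG q) : symmetry hq π ((cell q i)^[m] x) = (cell q (π i))^[m] (symmetry hq π x) :=
  Function.Semiconj.iterate_right (f := symmetry hq π) (fun x => symmetry_cell hq π i x) m x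

theorem symmetry_cellWord (hq : IsEquilateral q) (π : Equiv.Perm (Fin 3)) (w : List (Fin 3))
    (x : SG q) : symmetry hq π (cellWord q w x) = cellWord q (w.map π) (symmetry hq π x) := by
  induction w with
  | nil => rfl
  | cons i w ih => rw [cellWord, symmetry_cell, ih, List.map_cons, cellWord]

theorem symmetry_mem_vertices (hq : IsEquilateral q) (π : Equiv.Perm (Fin 3)) {m : ℕ} {x : SG q}
    (hx : x ∈ vertices q m) : symmetry hq π x ∈ vertices q m := by
  rw [mem_vertices] at hx ⊢
  obtain ⟨w, hw, i, rfl⟩ := hx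
  exact ⟨w.map π, by simpa using hw, π i, by rw [symmetry_cellWord, symmetry_corner]⟩

theorem adj_symmetry (hq : IsEquilateral q) (π : Equiv.Perm (Fin 3)) {m : ℕ} {x y : SG q}
    (h : (graph q m).Adj x y) : (graph q m).Adj (symmetry hq π x) (symmetry hq π y) := by
  obtain ⟨hne, w, hw, i, j, rfl, rfl⟩ := h
  exact ⟨fun h => hne (symmetry_injective hq π h), w.map π, by simpa using hw, π i, π j,
    by rw [symmetry_cellWord, symmetry_corner], by rw [symmetry_cellWord, symmetry_corner]⟩

theorem graphLaplacian_symmetry (hq : IsEquilateral q) (π : Equiv.Perm (Fin 3)) (m : ℕ)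
    (u : SG q → ℝ) (x : SG q) :
    graphLaplacian q m (fun y => u (symmetry hq π y)) x
      = graphLaplacian q m u (symmetry hq π x) := by
  classical
  have h1 : neighbors q m (symmetry hq π x) = (neighbors q m x).image (symmetry hq π) := by
    ext y
    rw [mem_neighbors, Finset.mem_image]
    constructor
    · intro h
      refine ⟨symmetry hq π.symm y, ?_,
        symmetry_symmetry_of_inverse hq π.apply_symm_apply y⟩
      have h2 := adj_symmetry hq π.symm h
      rw [symmetry_symmetry_of_inverse hq π.symm_apply_apply] at h2
      exact mem_neighbors.2 h2
    · rintro ⟨y, hy, rfl⟩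
      exact adj_symmetry hq π (mem_neighbors.1 hy)
  rw [graphLaplacian_eq, graphLaplacian_eq, h1,
    Finset.sum_image fun _ _ _ _ hxy => symmetry_injective hq π hxy]

/-- The composition of a function with a symmetry of the gasket. -/
def pull (hq : IsEquilateral q) (π : Equiv.Perm (Fin 3)) (u : C(SG q, ℝ)) : C(SG q, ℝ) :=
  u.comp (symmetry hq π)

@[simp] theorem pull_apply (hq : IsEquilateral q) (π : Equiv.Perm (Fin 3)) (u : C(SG q, ℝ))
    (x : SG q) : pull hq π u x = u (symmetry hq π x) := rfl

theorem HasLaplacian.pull (hq : IsEquilateral q) (π : Equiv.Perm (Fin 3)) {u f : C(SG q, ℝ)}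
    (hu : HasLaplacian q u f) :
    HasLaplacian q (SierpinskiGasket.pull hq π u) (SierpinskiGasket.pull hq π f) := by
  intro ε hε
  obtain ⟨M, hM⟩ := hu ε hε
  refine ⟨M, fun m hm x hx hx0 => ?_⟩
  have h := hM m hm _ (symmetry_mem_vertices hq π hx) fun h => hx0 (by
    have h1 := symmetry_mem_vertices hq π.symm h
    rwa [symmetry_symmetry_of_inverse hq π.symm_apply_apply] at h1)
  rw [← graphLaplacian_symmetry] at h
  exact h

theorem measurePreserving_symmetry (hq : IsEquilateral q) (π : Equiv.Perm (Fin 3)) :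
    MeasurePreserving (symmetry hq π) (mu q) (mu q) := by
  refine ⟨(symmetry hq π).continuous.measurable, ?_⟩
  have h1 : letterMeasure.map π = letterMeasure := by
    refine Measure.ext_of_singleton fun i => ?_
    have h2 : π ⁻¹' {i} = {π.symm i} := by
      ext k
      simp [Equiv.eq_symm_apply]
    rw [Measure.map_apply (measurable_of_finite π) (measurableSet_singleton i), h2,
      letterMeasure_singleton, letterMeasure_singleton]
  have h3 := Measure.infinitePi_map_pi (μ := fun _ : ℕ => letterMeasure) (f := fun _ => π)
    fun _ => measurable_of_finite π
  simp only [h1] at h3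
  rw [mu, Measure.map_map (symmetry hq π).continuous.measurable (measurable_addressSG q)]
  conv_rhs => rw [← h3]
  rw [Measure.map_map (measurable_addressSG q) (by fun_prop)]
  congr 1
  exact funext fun w => symmetry_addressSG hq π w

/-- The action of a symmetry of the gasket on `L²(SG)`. -/
def pullL2 (hq : IsEquilateral q) (π : Equiv.Perm (Fin 3)) : L2SG q →ₗᵢ[ℝ] L2SG q :=
  Lp.compMeasurePreservingₗᵢ ℝ (symmetry hq π) (measurePreserving_symmetry hq π)

theorem pullL2_toL2 (hq : IsEquilateral q) (π : Equiv.Perm (Fin 3)) (u : C(SG q, ℝ)) :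
    pullL2 hq π (toL2 q u) = toL2 q (pull hq π u) := by
  refine Lp.ext ?_
  have h1 : pullL2 hq π (toL2 q u) =ᵐ[mu q] toL2 q u ∘ symmetry hq π :=
    Lp.coeFn_compMeasurePreserving _ (measurePreserving_symmetry hq π)
  have h2 : toL2 q u =ᵐ[mu q] u := ContinuousMap.coeFn_toLp (mu q) u
  have h3 : toL2 q (pull hq π u) =ᵐ[mu q] pull hq π u := ContinuousMap.coeFn_toLp (mu q) _
  exact (h1.trans ((measurePreserving_symmetry hq π).quasiMeasurePreserving.ae_eq_comp h2)).trans
    h3.symm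

/-! ### Harmonic functions and their jets -/

theorem eq_or_eq_add_or_eq_sub (n k : Fin 3) : k = n ∨ k = n + 1 ∨ k = n - 1 := by
  revert n k; decide

theorem letters_ne (n : Fin 3) : n + 1 ≠ n ∧ n - 1 ≠ n ∧ n - 1 ≠ n + 1 := by
  revert n; decide

theorem sum_letters (n : Fin 3) (a : Fin 3 → ℝ) : ∑ k, a k = a n + a (n + 1) + a (n - 1) := by
  have h : (Finset.univ : Finset (Fin 3)) = {n, n + 1, n - 1} := by revert n; decide
  obtain ⟨h1, h2, h3⟩ := letters_ne n
  rw [h, Finset.sum_insert (by simp [h1.symm, h2.symm]), Finset.sum_pair h3.symm, add_assoc]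

/-- For $f=0$ all sources vanish, so both constructions subdivide by the same rule. This gives
`harm` its Laplacian. -/
theorem harm_eq_poisson (hq : IsEquilateral q) (a : Fin 3 → ℝ) : harm hq a = poisson hq 0 a := by
  have h0 : ∀ j, harmInt hq 0 j = 0 := fun j => by simp [harmInt]
  have hr : ∀ i, restr q i (0 : C(SG q, ℝ)) = 0 := fun i => rfl
  refine eq_of_eq_vertices hq fun w i => ?_
  induction w generalizing a with
  | nil => rw [cellWord, harm_corner, poisson_corner]
  | cons j w ih =>
    have h1 : subdivide (harmInt hq) 0 a j = harmRule a j := by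
      funext k
      simp [subdivide, harmRule, source, hr, h0]
    rw [cellWord, harm_cell, poisson_cell, h1, ih, hr, smul_zero]

theorem hasLaplacian_harm (hq : IsEquilateral q) (a : Fin 3 → ℝ) :
    HasLaplacian q (harm hq a) 0 := by
  rw [harm_eq_poisson]
  exact hasLaplacian_poisson hq 0 a

theorem HasLaplacian.eq_harm (hq : IsEquilateral q) {u : C(SG q, ℝ)} (hu : HasLaplacian q u 0) :
    u = harm hq fun i => u (corner q i) := by
  have h := hu.sub (hasLaplacian_harm hq fun i => u (corner q i))
  rw [sub_zero] at h
  exact sub_eq_zero.1 (h.eq_zero hq fun i => by simp [harm_corner])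

/-- The normal difference is an eigenfunctional, with eigenvalue $3/5$, of the harmonic rule at
$q_n$; the tangential difference below has eigenvalue $1/5$. Both renormalized sequences are
therefore constant. -/
theorem harm_normal (hq : IsEquilateral q) (a : Fin 3 → ℝ) (n : Fin 3) (m : ℕ) :
    2 * harm hq a (corner q n) - harm hq a ((cell q n)^[m] (corner q (n + 1)))
      - harm hq a ((cell q n)^[m] (corner q (n - 1)))
      = (3 / 5) ^ m * (2 * a n - a (n + 1) - a (n - 1)) := by
  induction m generalizing a with
  | zero => simp [harm_corner]
  | succ m ih =>
    have h := ih (harmRule a n)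
    have h1 : 2 * harmRule a n n - harmRule a n (n + 1) - harmRule a n (n - 1)
        = 3 / 5 * (2 * a n - a (n + 1) - a (n - 1)) := by
      obtain ⟨hn1, hn2, -⟩ := letters_ne n
      simp only [harmRule, if_true, if_neg hn1, if_neg hn2, sum_letters n a]
      ring
    rw [h1] at h
    conv_lhs => rw [← cell_corner_self q n]
    rw [Function.iterate_succ_apply', Function.iterate_succ_apply', harm_cell, harm_cell, harm_cell,
      h]
    ring

theorem harm_tangential (hq : IsEquilateral q) (a : Fin 3 → ℝ) (n : Fin 3) (m : ℕ) :
    harm hq a ((cell q n)^[m] (corner q (n + 1))) - harm hq a ((cell q n)^[m] (corner q (n - 1)))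
      = (1 / 5) ^ m * (a (n + 1) - a (n - 1)) := by
  induction m generalizing a with
  | zero => simp [harm_corner]
  | succ m ih =>
    have h := ih (harmRule a n)
    have h1 : harmRule a n (n + 1) - harmRule a n (n - 1) = 1 / 5 * (a (n + 1) - a (n - 1)) := by
      obtain ⟨hn1, hn2, -⟩ := letters_ne n
      simp only [harmRule, if_neg hn1, if_neg hn2]
      ring
    rw [h1] at h
    rw [Function.iterate_succ_apply', Function.iterate_succ_apply', harm_cell, harm_cell, h]
    ring

theorem hasNormalDeriv_harm (hq : IsEquilateral q) (a : Fin 3 → ℝ) (n : Fin 3) :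
    HasNormalDeriv q (harm hq a) n (2 * a n - a (n + 1) - a (n - 1)) := by
  have h : ∀ m : ℕ, (5 / 3 : ℝ) ^ m * (3 / 5) ^ m = 1 := fun m => by rw [← mul_pow]; norm_num
  simp only [HasNormalDeriv, harm_normal, ← mul_assoc, h, one_mul]
  exact tendsto_const_nhds

theorem hasTangentialDeriv_harm (hq : IsEquilateral q) (a : Fin 3 → ℝ) (n : Fin 3) :
    HasTangentialDeriv q (harm hq a) n (a (n + 1) - a (n - 1)) := by
  have h : ∀ m : ℕ, (5 : ℝ) ^ m * (1 / 5) ^ m = 1 := fun m => by rw [← mul_pow]; norm_num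
  simp only [HasTangentialDeriv, harm_tangential, ← mul_assoc, h, one_mul]
  exact tendsto_const_nhds

/-- A harmonic function with vanishing jet at a vertex vanishes. -/
theorem HasLaplacian.eq_zero_of_jet (hq : IsEquilateral q) {u : C(SG q, ℝ)}
    (hu : HasLaplacian q u 0) {n : Fin 3} (h0 : u (corner q n) = 0) (hn : HasNormalDeriv q u n 0)
    (ht : HasTangentialDeriv q u n 0) : u = 0 := by
  have h := hu.eq_harm hq
  have h1 := hasNormalDeriv_harm hq (fun i => u (corner q i)) n
  have h2 := hasTangentialDeriv_harm hq (fun i => u (corner q i)) n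
  rw [← h] at h1 h2
  have h3 := tendsto_nhds_unique h1 hn
  have h4 := tendsto_nhds_unique h2 ht
  refine hu.eq_zero hq fun i => ?_
  simp only [h0] at h3 h4
  rcases eq_or_eq_add_or_eq_sub n i with rfl | rfl | rfl
  · exact h0
  · linarith
  · linarith

/-! ### Iterated Laplacians -/

theorem HasIterLaplacian.unique (hq : IsEquilateral q) {k : ℕ} {u f g : C(SG q, ℝ)}
    (hf : HasIterLaplacian q k u f) (hg : HasIterLaplacian q k u g) : f = g := by
  induction k generalizing u with
  | zero => exact hf.symm.trans hg
  | succ k ih =>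
    obtain ⟨v, hv, hf⟩ := hf
    obtain ⟨w, hw, hg⟩ := hg
    obtain rfl := hv.unique hq hw
    exact ih hf hg

theorem HasIterLaplacian.sub {k : ℕ} {u v f g : C(SG q, ℝ)} (hf : HasIterLaplacian q k u f)
    (hg : HasIterLaplacian q k v g) : HasIterLaplacian q k (u - v) (f - g) := by
  induction k generalizing u v with
  | zero =>
    obtain rfl : u = f := hf
    obtain rfl : v = g := hg
    rfl
  | succ k ih =>
    obtain ⟨u', hu, hf⟩ := hf
    obtain ⟨v', hv, hg⟩ := hg
    exact ⟨u' - v', hu.sub hv, ih hf hg⟩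

theorem HasIterLaplacian.smul {k : ℕ} {u f : C(SG q, ℝ)} (hf : HasIterLaplacian q k u f) (c : ℝ) :
    HasIterLaplacian q k (c • u) (c • f) := by
  induction k generalizing u with
  | zero => exact congrArg (c • ·) hf
  | succ k ih =>
    obtain ⟨u', hu, hf⟩ := hf
    exact ⟨c • u', hu.smul c, ih hf⟩

theorem HasIterLaplacian.pull (hq : IsEquilateral q) (π : Equiv.Perm (Fin 3)) {k : ℕ}
    {u f : C(SG q, ℝ)} (hf : HasIterLaplacian q k u f) :
    HasIterLaplacian q k (SierpinskiGasket.pull hq π u) (SierpinskiGasket.pull hq π f) := by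
  induction k generalizing u with
  | zero => exact congrArg (SierpinskiGasket.pull hq π) hf
  | succ k ih =>
    obtain ⟨u', hu, hf⟩ := hf
    exact ⟨_, hu.pull hq π, ih hf⟩

theorem HasNormalDeriv.sub {u v : C(SG q, ℝ)} {n : Fin 3} {a b : ℝ} (hu : HasNormalDeriv q u n a)
    (hv : HasNormalDeriv q v n b) : HasNormalDeriv q (u - v : C(SG q, ℝ)) n (a - b) :=
  (Tendsto.sub hu hv).congr fun m => by simp only [ContinuousMap.sub_apply]; ring

theorem HasTangentialDeriv.sub {u v : C(SG q, ℝ)} {n : Fin 3} {a b : ℝ}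
    (hu : HasTangentialDeriv q u n a) (hv : HasTangentialDeriv q v n b) :
    HasTangentialDeriv q (u - v : C(SG q, ℝ)) n (a - b) :=
  (Tendsto.sub hu hv).congr fun m => by simp only [ContinuousMap.sub_apply]; ring

theorem HasNormalDeriv.smul {u : C(SG q, ℝ)} {n : Fin 3} {a : ℝ} (hu : HasNormalDeriv q u n a)
    (c : ℝ) : HasNormalDeriv q (c • u : C(SG q, ℝ)) n (c * a) :=
  (Tendsto.const_mul c hu).congr fun m => by
    simp only [ContinuousMap.smul_apply, smul_eq_mul]; ring

theorem HasTangentialDeriv.smul {u : C(SG q, ℝ)} {n : Fin 3} {a : ℝ}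
    (hu : HasTangentialDeriv q u n a) (c : ℝ) :
    HasTangentialDeriv q (c • u : C(SG q, ℝ)) n (c * a) :=
  (Tendsto.const_mul c hu).congr fun m => by
    simp only [ContinuousMap.smul_apply, smul_eq_mul]; ring

/-- A polynomial with vanishing jets at a vertex vanishes. -/
theorem eq_zero_of_jets (hq : IsEquilateral q) {n : Fin 3} {j : ℕ} {u : C(SG q, ℝ)}
    (hu : HasIterLaplacian q (j + 1) u 0)
    (h : ∀ m ≤ j, ∃ f : C(SG q, ℝ), HasIterLaplacian q m u f ∧ f (corner q n) = 0 ∧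
      HasNormalDeriv q f n 0 ∧ HasTangentialDeriv q f n 0) : u = 0 := by
  induction j generalizing u with
  | zero =>
    obtain ⟨v, hv, rfl⟩ := hu
    obtain ⟨f, rfl, h1, h2, h3⟩ := h 0 le_rfl
    exact hv.eq_zero_of_jet hq h1 h2 h3
  | succ j ih =>
    obtain ⟨v, hv, hv'⟩ := hu
    obtain rfl : v = 0 := by
      refine ih hv' fun m hm => ?_
      obtain ⟨f, ⟨v', hv1, hf⟩, h2⟩ := h (m + 1) (by omega)
      obtain rfl := hv.unique hq hv1
      exact ⟨f, hf, h2⟩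
    obtain ⟨f, rfl, h1, h2, h3⟩ := h 0 (Nat.zero_le _)
    exact hv.eq_zero_of_jet hq h1 h2 h3

/-! ### Monomials -/

theorem IsMonomial.unique (hq : IsEquilateral q) {n : Fin 3} {j i : ℕ} {P P' : C(SG q, ℝ)}
    (h : IsMonomial q n j i P) (h' : IsMonomial q n j i P') : P = P' := by
  refine sub_eq_zero.1 (eq_zero_of_jets hq (n := n) (j := j) ?_ fun m hm => ?_)
  · have h1 := HasIterLaplacian.sub h.1 h'.1
    rwa [sub_zero] at h1
  · obtain ⟨f, hf, h0, hn, ht⟩ := h.2 m hm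
    obtain ⟨g, hg, h0', hn', ht'⟩ := h'.2 m hm
    refine ⟨f - g, hf.sub hg, ?_, ?_, ?_⟩
    · rw [ContinuousMap.sub_apply, h0, h0', sub_self]
    · simpa only [sub_self] using hn.sub hn'
    · simpa only [sub_self] using ht.sub ht'

theorem IsMonomial.exists_hasLaplacian (hq : IsEquilateral q) {n : Fin 3} {j i : ℕ}
    {P : C(SG q, ℝ)} (h : IsMonomial q n (j + 1) i P) :
    ∃ P', HasLaplacian q P P' ∧ IsMonomial q n j i P' := by
  obtain ⟨⟨v, hv, hv'⟩, h⟩ := h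
  refine ⟨v, hv, hv', fun m hm => ?_⟩
  obtain ⟨f, ⟨v', hv1, hf⟩, h2⟩ := h (m + 1) (by omega)
  obtain rfl := hv.unique hq hv1
  refine ⟨f, hf, ?_⟩
  simpa only [add_left_inj] using h2

/-- A monomial of degree $j+1$ is a primitive of the one of degree $j$ with zero jet at $q_n$, so
existence can go by induction. -/
theorem IsMonomial.succ {n : Fin 3} {j i : ℕ} {P p : C(SG q, ℝ)}
    (h : IsMonomial q n j i p) (hP : HasLaplacian q P p) (h0 : P (corner q n) = 0)
    (hn : HasNormalDeriv q P n 0) (ht : HasTangentialDeriv q P n 0) :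
    IsMonomial q n (j + 1) i P := by
  refine ⟨⟨p, hP, h.1⟩, fun m hm => ?_⟩
  cases m with
  | zero => exact ⟨P, rfl, by simpa using h0, by simpa using hn, by simpa using ht⟩
  | succ m =>
    obtain ⟨f, hf, h2⟩ := h.2 m (by omega)
    refine ⟨f, ⟨p, hP, hf⟩, ?_⟩
    simpa only [add_left_inj] using h2

theorem isMonomial_zero_one (hq : IsEquilateral q) (n : Fin 3) :
    IsMonomial q n 0 1 (harm hq fun _ => 1) := by
  refine ⟨⟨0, hasLaplacian_harm hq _, rfl⟩, fun m hm => ?_⟩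
  obtain rfl := Nat.le_zero.1 hm
  refine ⟨_, rfl, by simp [harm_corner], ?_, ?_⟩
  · convert hasNormalDeriv_harm hq (fun _ => 1) n using 1
    norm_num
  · convert hasTangentialDeriv_harm hq (fun _ => 1) n using 1
    norm_num

/-- The boundary values of the monomial of degree zero with tangential derivative one. -/
def tangentialData (n k : Fin 3) : ℝ := if k = n then 0 else if k = n + 1 then 1 / 2 else -1 / 2

theorem isMonomial_zero_three (hq : IsEquilateral q) (n : Fin 3) :
    IsMonomial q n 0 3 (harm hq (tangentialData n)) := by
  refine ⟨⟨0, hasLaplacian_harm hq _, rfl⟩, fun m hm => ?_⟩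
  obtain rfl := Nat.le_zero.1 hm
  refine ⟨_, rfl, by simp [harm_corner, tangentialData], ?_, ?_⟩
  · convert hasNormalDeriv_harm hq (tangentialData n) n using 1
    simp [tangentialData, letters_ne n]
    norm_num
  · convert hasTangentialDeriv_harm hq (tangentialData n) n using 1
    simp [tangentialData, letters_ne n]
    norm_num

/-! ### Homogeneous primitives at a vertex and the existence of monomials. -/

theorem restr_harm (hq : IsEquilateral q) (a : Fin 3 → ℝ) (i : Fin 3) :
    restr q i (harm hq a) = harm hq (harmRule a i) :=
  ContinuousMap.ext fun x => harm_cell hq a i x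

theorem pull_harm (hq : IsEquilateral q) (a : Fin 3 → ℝ) (π : Equiv.Perm (Fin 3)) :
    pull hq π (harm hq a) = harm hq fun k => a (π k) := by
  have h : HasLaplacian q (pull hq π (harm hq a)) 0 := (hasLaplacian_harm hq a).pull hq π
  rw [h.eq_harm hq]
  simp [symmetry_corner, harm_corner]

/-- The reflection that fixes the vertex `n`. -/
def reflection (n : Fin 3) : Equiv.Perm (Fin 3) := Equiv.swap (n + 1) (n - 1)

theorem reflection_self (n : Fin 3) : reflection n n = n := by revert n; decide

theorem reflection_add (n : Fin 3) : reflection n (n + 1) = n - 1 := by revert n; decide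

theorem reflection_sub (n : Fin 3) : reflection n (n - 1) = n + 1 := by revert n; decide

theorem reflection_reflection (n k : Fin 3) : reflection n (reflection n k) = k := by
  revert n k; decide

theorem pull_pull_reflection (hq : IsEquilateral q) (n : Fin 3) (u : C(SG q, ℝ)) :
    pull hq (reflection n) (pull hq (reflection n) u) = u :=
  ContinuousMap.ext fun x =>
    congrArg u (symmetry_symmetry_of_inverse hq (reflection_reflection n) x)

/-- The harmonic corrections that make a solution homogeneous under the contraction towards a
vertex. -/
theorem exists_harmRule_sub_eq {ε κ : ℝ} (hε : ε = 1 ∧ κ ≠ 1 ∧ κ ≠ 3 / 5 ∨ ε = -1 ∧ κ ≠ 1 / 5)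
    (n : Fin 3) (c : Fin 3 → ℝ) (hc : ∀ k, c (reflection n k) = ε * c k) :
    ∃ b : Fin 3 → ℝ, harmRule b n - κ • b = c ∧ ∀ k, b (reflection n k) = ε * b k := by
  have hn := hc n
  have hn1 := hc (n + 1)
  rw [reflection_self] at hn
  rw [reflection_add] at hn1
  have hsplit := eq_or_eq_add_or_eq_sub n
  have hne := letters_ne n
  -- With the parity imposed, the values are $s$ at $q_n$ and $t,\varepsilon t$ at the others, and
  -- the system is triangular. The rule at $q_n$ has eigenvalues $1,3/5$ on even data and $1/5$ on
  -- odd data, exactly the excluded $\kappa$.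
  obtain ⟨s, t, hs, ht, hs'⟩ : ∃ s t : ℝ, s - κ * s = c n ∧
      (2 * s + (2 + ε) * t) / 5 - κ * t = c (n + 1) ∧ s = ε * s := by
    rcases hε with ⟨rfl, h1, h2⟩ | ⟨rfl, h1⟩
    · have h1' : 1 - κ ≠ 0 := sub_ne_zero.2 h1.symm
      have h2' : 3 / 5 - κ ≠ 0 := sub_ne_zero.2 h2.symm
      refine ⟨c n / (1 - κ), (c (n + 1) - 2 / 5 * (c n / (1 - κ))) / (3 / 5 - κ), ?_, ?_,
        (one_mul _).symm⟩
      · linear_combination mul_div_cancel₀ (c n) h1'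
      · linear_combination mul_div_cancel₀ (c (n + 1) - 2 / 5 * (c n / (1 - κ))) h2'
    · have h1' : 1 / 5 - κ ≠ 0 := sub_ne_zero.2 h1.symm
      refine ⟨0, c (n + 1) / (1 / 5 - κ), by linarith, ?_, by simp⟩
      linear_combination mul_div_cancel₀ (c (n + 1)) h1'
  have hε2 : ε * ε = 1 := by
    rcases hε with ⟨rfl, -⟩ | ⟨rfl, -⟩ <;> norm_num
  set b : Fin 3 → ℝ := fun k => if k = n then s else if k = n + 1 then t else ε * t with hb
  have b0 : b n = s := by simp [hb]
  have b1 : b (n + 1) = t := by simp [hb, hne.1]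
  have b2 : b (n - 1) = ε * t := by simp [hb, hne.2.1, hne.2.2]
  have hsum : ∑ l, b l = s + t + ε * t := by
    rw [sum_letters n, b0, b1, b2]
  refine ⟨b, funext fun k => ?_, fun k => ?_⟩
  · simp only [Pi.sub_apply, Pi.smul_apply, smul_eq_mul, harmRule, hsum]
    rcases hsplit k with rfl | rfl | rfl
    · rw [if_pos rfl, b0, hs]
    · rw [if_neg hne.1, b0, b1]
      linear_combination ht
    · rw [if_neg hne.2.1, b0, b2, hn1]
      linear_combination ε * ht + 2 / 5 * hs' - t / 5 * hε2
  · rcases hsplit k with rfl | rfl | rfl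
    · rw [reflection_self, b0]; exact hs'
    · rw [reflection_add, b1, b2]
    · rw [reflection_sub, b1, b2]
      linear_combination (-t) * hε2

/-- A homogeneous function of definite parity at a vertex has a homogeneous primitive of the same
parity. -/
theorem exists_homogeneous_primitive (hq : IsEquilateral q) {ε κ : ℝ}
    (hε : ε = 1 ∧ κ ≠ 1 ∧ κ ≠ 3 / 5 ∨ ε = -1 ∧ κ ≠ 1 / 5) {n : Fin 3} {p : C(SG q, ℝ)}
    (hp : restr q n p = (5 * κ) • p) (hp' : pull hq (reflection n) p = ε • p) :
    ∃ u, HasLaplacian q u p ∧ restr q n u = κ • u ∧ pull hq (reflection n) u = ε • u := by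
  have hε2 : ε * ε = 1 := by
    rcases hε with ⟨rfl, -⟩ | ⟨rfl, -⟩ <;> norm_num
  have padd : ∀ u v : C(SG q, ℝ), pull hq (reflection n) (u + v)
      = pull hq (reflection n) u + pull hq (reflection n) v := fun _ _ => rfl
  have psmul : ∀ (c : ℝ) (u : C(SG q, ℝ)), pull hq (reflection n) (c • u)
      = c • pull hq (reflection n) u := fun _ _ => rfl
  have radd : ∀ u v : C(SG q, ℝ), restr q n (u + v) = restr q n u + restr q n v := fun _ _ => rfl
  have hv := hasLaplacian_poisson hq p 0
  set v := poisson hq p 0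
  -- Projection onto the parity class; it keeps the Laplacian because $p$ has that parity.
  set w := (1 / 2 : ℝ) • v + (ε / 2) • pull hq (reflection n) v with hw
  have hwL : HasLaplacian q w p := by
    have h := (hv.smul (1 / 2)).add ((hv.pull hq (reflection n)).smul (ε / 2))
    rw [hp', smul_smul, ← add_smul, show 1 / 2 + ε / 2 * ε = 1 by linarith, one_smul] at h
    exact h
  have hwp : pull hq (reflection n) w = ε • w := by
    rw [hw, padd, psmul, psmul, pull_pull_reflection, smul_add, smul_smul, smul_smul,
      show ε * (ε / 2) = 1 / 2 by linarith, add_comm]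
    congr 2
    ring
  clear_value w
  -- The failure of homogeneity is harmonic, since $\frac15\cdot5\kappa=\kappa$. It can therefore be
  -- removed by adding a harmonic function.
  set h := κ • w - restr q n w with hh
  have hhL : HasLaplacian q h 0 := by
    have h1 := (hwL.smul κ).sub (hwL.restr hq n)
    rw [hp, smul_smul, show 1 / 5 * (5 * κ) = κ by ring, sub_self] at h1
    exact h1
  obtain ⟨b, hb, hb'⟩ := exists_harmRule_sub_eq hε n (fun k => h (corner q k)) fun k => by
    have h1 := congrArg (fun f : C(SG q, ℝ) => f (corner q k)) hwp
    have h2 := congrArg (fun f : C(SG q, ℝ) => f (cell q n (corner q k))) hwp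
    simp only [pull_apply, symmetry_cell, symmetry_corner, reflection_self,
      ContinuousMap.smul_apply, smul_eq_mul] at h1 h2
    simp only [hh, ContinuousMap.sub_apply, ContinuousMap.smul_apply, smul_eq_mul, restr_apply,
      h1, h2]
    ring
  refine ⟨w + harm hq b, by simpa using hwL.add (hasLaplacian_harm hq b), ?_, ?_⟩
  · have h1 : harm hq (harmRule b n) - κ • harm hq b = h := by
      rw [hhL.eq_harm hq, ← hb, sub_eq_add_neg, sub_eq_add_neg, ← neg_smul, ← neg_smul, harm_add,
        harm_smul]
    rw [radd, restr_harm, smul_add, ← sub_eq_zero]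
    rw [hh] at h1
    linear_combination (exp := 1) h1
  · rw [padd, hwp, pull_harm, smul_add, ← harm_smul]
    congr 2
    exact funext hb'

/-- Homogeneous functions have vanishing jets at the vertex if the degree is high enough. -/
theorem jet_eq_zero_of_homogeneous {κ : ℝ} (hκ0 : 0 ≤ κ) (hκ : κ < 3 / 5) {n : Fin 3}
    {u : C(SG q, ℝ)} (hu : restr q n u = κ • u)
    (ht : κ < 1 / 5 ∨ u (corner q (n + 1)) = u (corner q (n - 1))) :
    u (corner q n) = 0 ∧ HasNormalDeriv q u n 0 ∧ HasTangentialDeriv q u n 0 := by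
  have h1 : ∀ x, u (cell q n x) = κ * u x := fun x =>
    congrArg (fun f : C(SG q, ℝ) => f x) hu
  have h2 : ∀ (m : ℕ) x, u ((cell q n)^[m] x) = κ ^ m * u x := by
    intro m x
    induction m with
    | zero => simp
    | succ m ih => rw [Function.iterate_succ_apply', h1, ih, pow_succ']; ring
  have h3 : u (corner q n) = 0 := by
    have h := h1 (corner q n)
    rw [cell_corner_self] at h
    have h4 : (1 - κ) * u (corner q n) = 0 := by linarith
    rcases mul_eq_zero.1 h4 with h5 | h5
    · linarith
    · exact h5
  refine ⟨h3, ?_, ?_⟩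
  · have h4 := (tendsto_pow_atTop_nhds_zero_of_lt_one (r := 5 / 3 * κ) (by positivity)
      (by linarith)).mul_const (-u (corner q (n + 1)) - u (corner q (n - 1)))
    rw [zero_mul] at h4
    refine h4.congr fun m => ?_
    rw [h2, h2, h3, mul_pow]
    ring
  · rcases ht with ht | ht
    · have h4 := (tendsto_pow_atTop_nhds_zero_of_lt_one (r := 5 * κ) (by positivity)
        (by linarith)).mul_const (u (corner q (n + 1)) - u (corner q (n - 1)))
      rw [zero_mul] at h4
      refine h4.congr fun m => ?_
      rw [h2, h2, mul_pow]
      ring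
    · refine tendsto_const_nhds.congr fun m => ?_
      rw [h2, h2, ht]
      ring

theorem exists_isMonomial_one (hq : IsEquilateral q) (n : Fin 3) (j : ℕ) :
    ∃ P, IsMonomial q n j 1 P ∧ restr q n P = ((1 / 5 : ℝ) ^ j) • P ∧
      pull hq (reflection n) P = (1 : ℝ) • P := by
  induction j with
  | zero =>
    refine ⟨_, isMonomial_zero_one hq n, ?_, ?_⟩ <;>
    · ext x
      simp [harm_const]
  | succ j ih =>
    obtain ⟨p, hp, hr, hs⟩ := ih
    have hk : (1 / 5 : ℝ) ^ (j + 1) ≤ 1 / 5 := by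
      rw [pow_succ]
      have : (1 / 5 : ℝ) ^ j ≤ 1 := pow_le_one₀ (by norm_num) (by norm_num)
      linarith
    -- At $j=0$, $\kappa=1/5$ is resonant with the odd harmonic function; working among even
    -- functions avoids this, and evenness also makes the tangential derivative vanish.
    obtain ⟨u, hu, hur, hus⟩ := exists_homogeneous_primitive hq (ε := 1) (κ := (1 / 5) ^ (j + 1))
      (Or.inl ⟨rfl, by linarith, by linarith⟩) (n := n) (p := p)
      (by rw [hr, pow_succ]; congr 1; ring) hs
    obtain ⟨h0, hn, ht⟩ := jet_eq_zero_of_homogeneous (by positivity) (by linarith) hur (Or.inr (by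
      have h := congrArg (fun f : C(SG q, ℝ) => f (corner q (n - 1))) hus
      simpa [symmetry_corner, reflection_sub] using h))
    exact ⟨u, hp.succ hu h0 hn ht, hur, hus⟩

/-- The chain starts at the odd harmonic function of eigenvalue $1/5$. All later exponents are at
most $1/25$, so neither resonance nor a tangential term arises. -/
theorem exists_isMonomial_three (hq : IsEquilateral q) (n : Fin 3) (j : ℕ) :
    ∃ P, IsMonomial q n j 3 P ∧ restr q n P = ((1 / 5 : ℝ) ^ (j + 1)) • P ∧
      pull hq (reflection n) P = (-1 : ℝ) • P := by
  induction j with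
  | zero =>
    refine ⟨_, isMonomial_zero_three hq n, ?_, ?_⟩
    · rw [restr_harm, ← harm_smul]
      congr 1
      funext k
      have hne := letters_ne n
      rcases eq_or_eq_add_or_eq_sub n k with h | h | h <;>
        simp [h, harmRule, tangentialData, sum_letters n, hne] <;> norm_num
    · rw [pull_harm, ← harm_smul]
      congr 1
      funext k
      have hne := letters_ne n
      rcases eq_or_eq_add_or_eq_sub n k with rfl | rfl | rfl
      · simp [tangentialData, reflection_self]
      · simp [tangentialData, reflection_add, hne]; norm_num
      · simp [tangentialData, reflection_sub, hne]; norm_num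
  | succ j ih =>
    obtain ⟨p, hp, hr, hs⟩ := ih
    have hk : (1 / 5 : ℝ) ^ (j + 1 + 1) ≤ 1 / 25 := by
      rw [pow_succ, pow_succ]
      have : (1 / 5 : ℝ) ^ j ≤ 1 := pow_le_one₀ (by norm_num) (by norm_num)
      linarith
    obtain ⟨u, hu, hur, hus⟩ := exists_homogeneous_primitive hq (ε := -1)
      (κ := (1 / 5) ^ (j + 1 + 1)) (Or.inr ⟨rfl, by linarith⟩) (n := n) (p := p)
      (by rw [hr, pow_succ _ (j + 1)]; congr 1; ring) hs
    obtain ⟨h0, hn, ht⟩ := jet_eq_zero_of_homogeneous (by positivity) (by linarith) hur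
      (Or.inl (by linarith))
    exact ⟨u, hp.succ hu h0 hn ht, hur, hus⟩

/-! ### Symmetries of monomials -/

/-- The sign of a permutation of the vertices, as a real number. -/
def sgn (π : Equiv.Perm (Fin 3)) : ℝ := ((Equiv.Perm.sign π : ℤ) : ℝ)

/-- A permutation of three letters preserves or reverses the cyclic order, according to its sign.
Hence normal derivatives are invariant under symmetries and tangential ones pick up the sign. -/
theorem sgn_cases (π : Equiv.Perm (Fin 3)) (n : Fin 3) :
    (sgn π = 1 ∧ π (n + 1) = π n + 1 ∧ π (n - 1) = π n - 1) ∨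
      (sgn π = -1 ∧ π (n + 1) = π n - 1 ∧ π (n - 1) = π n + 1) := by
  have h : (Equiv.Perm.sign π = 1 ∧ π (n + 1) = π n + 1 ∧ π (n - 1) = π n - 1) ∨
      (Equiv.Perm.sign π = -1 ∧ π (n + 1) = π n - 1 ∧ π (n - 1) = π n + 1) := by
    revert π n; decide
  rcases h with ⟨h, h'⟩ | ⟨h, h'⟩
  · exact Or.inl ⟨by simp [sgn, h], h'⟩
  · exact Or.inr ⟨by simp [sgn, h], h'⟩

theorem sgn_mul_self (π : Equiv.Perm (Fin 3)) : sgn π * sgn π = 1 := by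
  rcases sgn_cases π 0 with ⟨h, -⟩ | ⟨h, -⟩ <;> rw [h] <;> norm_num

theorem sgn_reflection (n : Fin 3) : sgn (reflection n) = -1 := by
  have h := (letters_ne n).2.2.symm
  simp [sgn, reflection, Equiv.Perm.sign_swap h]

theorem HasNormalDeriv.pull (hq : IsEquilateral q) {π : Equiv.Perm (Fin 3)} {u : C(SG q, ℝ)}
    {n : Fin 3} {d : ℝ} (h : HasNormalDeriv q u (π n) d) :
    HasNormalDeriv q (SierpinskiGasket.pull hq π u) n d := by
  refine Tendsto.congr (fun m => ?_) h
  simp only [pull_apply, symmetry_iterate_cell, symmetry_corner]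
  rcases sgn_cases π n with ⟨-, h1, h2⟩ | ⟨-, h1, h2⟩ <;> rw [h1, h2]
  ring

theorem HasTangentialDeriv.pull (hq : IsEquilateral q) {π : Equiv.Perm (Fin 3)} {u : C(SG q, ℝ)}
    {n : Fin 3} {d : ℝ} (h : HasTangentialDeriv q u (π n) d) :
    HasTangentialDeriv q (SierpinskiGasket.pull hq π u) n (sgn π * d) := by
  refine Tendsto.congr (fun m => ?_) (Tendsto.const_mul (sgn π) h)
  simp only [pull_apply, symmetry_iterate_cell, symmetry_corner]
  rcases sgn_cases π n with ⟨h0, h1, h2⟩ | ⟨h0, h1, h2⟩ <;> rw [h0, h1, h2] <;> ring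

theorem IsMonomial.pull (hq : IsEquilateral q) {π : Equiv.Perm (Fin 3)} {n : Fin 3} {j i : ℕ}
    {c : ℝ} (hc : i = 1 ∧ c = 1 ∨ i = 3 ∧ c = sgn π) {P : C(SG q, ℝ)}
    (h : IsMonomial q (π n) j i P) :
    IsMonomial q n j i (c • SierpinskiGasket.pull hq π P) := by
  refine ⟨?_, fun m hm => ?_⟩
  · have h1 := (HasIterLaplacian.pull hq π h.1).smul c
    have h2 : c • SierpinskiGasket.pull hq π (0 : C(SG q, ℝ)) = 0 := by
      ext x
      simp
    rwa [h2] at h1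
  · obtain ⟨f, hf, h0, hn, ht⟩ := h.2 m hm
    refine ⟨_, (hf.pull hq π).smul c, ?_, ?_, ?_⟩
    · rw [ContinuousMap.smul_apply, pull_apply, symmetry_corner, h0]
      rcases hc with ⟨rfl, rfl⟩ | ⟨rfl, rfl⟩ <;> simp
    · convert (hn.pull hq).smul c using 1
      rcases hc with ⟨rfl, rfl⟩ | ⟨rfl, rfl⟩ <;> simp
    · convert (ht.pull hq).smul c using 1
      rcases hc with ⟨rfl, rfl⟩ | ⟨rfl, rfl⟩
      · simp
      · rw [← mul_assoc, sgn_mul_self, one_mul]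

theorem isMonomial_monomial (hq : IsEquilateral q) (n : Fin 3) (j : ℕ) {i : ℕ}
    (hi : i = 1 ∨ i = 3) : IsMonomial q n j i (monomial q n j i) := by
  have h : ∃ P, IsMonomial q n j i P := by
    rcases hi with rfl | rfl
    · exact (exists_isMonomial_one hq n j).imp fun _ h => h.1
    · exact (exists_isMonomial_three hq n j).imp fun _ h => h.1
  rw [monomial, dif_pos h]
  exact h.choose_spec

theorem smul_pull_monomial_three (hq : IsEquilateral q) (π : Equiv.Perm (Fin 3)) (n : Fin 3)
    (j : ℕ) : sgn π • pull hq π (monomial q (π n) j 3) = monomial q n j 3 :=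
  ((isMonomial_monomial hq (π n) j (Or.inr rfl)).pull hq (Or.inr ⟨rfl, rfl⟩)).unique hq
    (isMonomial_monomial hq n j (Or.inr rfl))

theorem pull_monomial_one (hq : IsEquilateral q) (π : Equiv.Perm (Fin 3)) (n : Fin 3)
    (j : ℕ) : pull hq π (monomial q (π n) j 1) = monomial q n j 1 := by
  rw [← one_smul ℝ (pull hq π _)]
  exact ((isMonomial_monomial hq (π n) j (Or.inl rfl)).pull hq (Or.inl ⟨rfl, rfl⟩)).unique hq
    (isMonomial_monomial hq n j (Or.inl rfl))

theorem hasLaplacian_monomial_zero (hq : IsEquilateral q) (n : Fin 3) {i : ℕ}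
    (hi : i = 1 ∨ i = 3) : HasLaplacian q (monomial q n 0 i) 0 := by
  obtain ⟨v, hv, rfl⟩ := (isMonomial_monomial hq n 0 hi).1
  exact hv

theorem hasLaplacian_monomial_succ (hq : IsEquilateral q) (n : Fin 3) (j : ℕ) {i : ℕ}
    (hi : i = 1 ∨ i = 3) : HasLaplacian q (monomial q n (j + 1) i) (monomial q n j i) := by
  obtain ⟨P, hP, hP'⟩ := (isMonomial_monomial hq n (j + 1) hi).exists_hasLaplacian hq
  rwa [hP'.unique hq (isMonomial_monomial hq n j hi)] at hP

theorem pull_symMonomial (hq : IsEquilateral q) (π : Equiv.Perm (Fin 3)) (j : ℕ) :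
    pull hq π (symMonomial q j) = symMonomial q j := by
  have h : pull hq π (symMonomial q j) = ∑ n, pull hq π (monomial q n j 1) := by
    ext x
    simp [symMonomial]
  rw [h, ← Equiv.sum_comp π, symMonomial]
  exact Finset.sum_congr rfl fun n _ => pull_monomial_one hq π n j

/-- The sum is odd under every reflection, so it vanishes at each fixed vertex; its Laplacian is the
sum of one degree less. Induction and uniqueness for the Dirichlet problem conclude. -/
theorem sum_monomial_three (hq : IsEquilateral q) (j : ℕ) : ∑ n, monomial q n j 3 = 0 := by
  have hcorner : ∀ j k, (∑ n, monomial q n j 3) (corner q k) = 0 := by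
    intro j k
    have h : ∑ n, monomial q n j 3
        = (-1 : ℝ) • pull hq (reflection k) (∑ n, monomial q n j 3) := by
      have h1 : pull hq (reflection k) (∑ n, monomial q n j 3)
          = ∑ n, pull hq (reflection k) (monomial q n j 3) := by
        ext x
        simp
      conv_rhs => rw [h1, ← Equiv.sum_comp (reflection k), Finset.smul_sum]
      refine Finset.sum_congr rfl fun n _ => ?_
      rw [← sgn_reflection k, smul_pull_monomial_three]
    have h1 := congrArg (fun f : C(SG q, ℝ) => f (corner q k)) h
    simp only [ContinuousMap.smul_apply, pull_apply, symmetry_corner, reflection_self,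
      smul_eq_mul] at h1
    linarith
  induction j with
  | zero =>
    have h := HasLaplacian.sum Finset.univ fun (n : Fin 3) _ =>
      hasLaplacian_monomial_zero hq n (i := 3) (Or.inr rfl)
    rw [Finset.sum_const_zero] at h
    exact h.eq_zero hq (hcorner 0)
  | succ j ih =>
    have h := HasLaplacian.sum Finset.univ fun (n : Fin 3) _ =>
      hasLaplacian_monomial_succ hq n j (i := 3) (Or.inr rfl)
    rw [ih] at h
    exact h.eq_zero hq (hcorner (j + 1))

/-! ### Linear independence -/

/-- Applying $\Delta$ to a linear relation shifts it down the chain and drops one term, so by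
induction only the coefficient of $u_0\ne0$ is left. -/
theorem linearIndependent_of_hasLaplacian (hq : IsEquilateral q) {u : ℕ → C(SG q, ℝ)}
    (h0 : u 0 ≠ 0) (hL : HasLaplacian q (u 0) 0) (hS : ∀ k, HasLaplacian q (u (k + 1)) (u k)) :
    LinearIndependent ℝ u := by
  have key : ∀ (N : ℕ) (c : ℕ → ℝ), ∑ k ∈ Finset.range N, c k • u k = 0 →
      ∀ k < N, c k = 0 := by
    intro N
    induction N with
    | zero => intro c _ k hk; omega
    | succ N ih =>
      intro c hc
      rw [Finset.sum_range_succ'] at hc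
      have h1 := (HasLaplacian.sum (Finset.range N) fun k _ => (hS k).smul (c (k + 1))).add
        (hL.smul (c 0))
      rw [hc, smul_zero, add_zero] at h1
      have h2 := ih (fun k => c (k + 1)) (h1.unique hq hasLaplacian_zero)
      rintro (_ | k) hk
      · rw [Finset.sum_eq_zero fun k hk => by rw [h2 k (Finset.mem_range.1 hk), zero_smul],
          zero_add] at hc
        exact (smul_eq_zero.1 hc).resolve_right h0
      · exact h2 k (by omega)
  rw [linearIndependent_iff'']
  intro s g hg hsum i
  obtain ⟨n, hn⟩ := s.exists_nat_subset_range
  by_cases hi : i ∈ s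
  · refine key n g ?_ i (Finset.mem_range.1 (hn hi))
    rw [← Finset.sum_subset hn fun k _ hk => by rw [hg k hk, zero_smul], hsum]
  · exact hg i hi

theorem linearIndependent_toL2 {u : ℕ → C(SG q, ℝ)} (hu : LinearIndependent ℝ u) :
    LinearIndependent ℝ fun k => toL2 q (u k) :=
  hu.map' (ContinuousMap.toLp (E := ℝ) 2 (mu q) ℝ).toLinearMap
    (LinearMap.ker_eq_bot.2 (ContinuousMap.toLp_injective (mu q)))

theorem linearIndependent_monomial_three (hq : IsEquilateral q) (n : Fin 3) :
    LinearIndependent ℝ fun k => toL2 q (monomial q n k 3) := by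
  refine linearIndependent_toL2 (linearIndependent_of_hasLaplacian hq ?_
    (hasLaplacian_monomial_zero hq n (Or.inr rfl))
    fun k => hasLaplacian_monomial_succ hq n k (Or.inr rfl))
  rw [(isMonomial_monomial hq n 0 (Or.inr rfl)).unique hq (isMonomial_zero_three hq n)]
  intro h
  have h1 := congrArg (fun f : C(SG q, ℝ) => f (corner q (n + 1))) h
  simp [harm_corner, tangentialData, letters_ne n] at h1

theorem linearIndependent_symMonomial (hq : IsEquilateral q) :
    LinearIndependent ℝ fun k => toL2 q (symMonomial q k) := by
  have hL := HasLaplacian.sum Finset.univ fun (n : Fin 3) _ =>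
    hasLaplacian_monomial_zero hq n (i := 1) (Or.inl rfl)
  rw [Finset.sum_const_zero] at hL
  refine linearIndependent_toL2 (linearIndependent_of_hasLaplacian hq ?_ hL fun k =>
    HasLaplacian.sum Finset.univ fun (n : Fin 3) _ =>
      hasLaplacian_monomial_succ hq n k (i := 1) (Or.inl rfl))
  have h1 : ∀ n, monomial q n 0 1 = harm hq fun _ => 1 := fun n =>
    (isMonomial_monomial hq n 0 (Or.inl rfl)).unique hq (isMonomial_zero_one hq n)
  intro h
  have h2 := congrArg (fun f : C(SG q, ℝ) => f (corner q 0)) h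
  simp only [symMonomial, h1, Fin.sum_univ_three, ContinuousMap.add_apply, harm_corner,
    ContinuousMap.zero_apply] at h2
  norm_num at h2

/-! ### The Gram-Schmidt process -/

section GramSchmidt

open InnerProductSpace

variable {E : Type*} [NormedAddCommGroup E] [InnerProductSpace ℝ E]

/-- The Gram-Schmidt process commutes with isometries. -/
theorem gramSchmidtNormed_map (L : E →ₗ[ℝ] E) (hL : ∀ x y, inner ℝ (L x) (L y) = inner ℝ x y)
    (f : ℕ → E) (n : ℕ) :
    gramSchmidtNormed ℝ (fun k => L (f k)) n = L (gramSchmidtNormed ℝ f n) := by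
  have hnorm : ∀ x, ‖L x‖ = ‖x‖ := fun x => by
    rw [← sq_eq_sq₀ (norm_nonneg _) (norm_nonneg _), ← real_inner_self_eq_norm_sq,
      ← real_inner_self_eq_norm_sq, hL]
  have h : ∀ n, gramSchmidt ℝ (fun k => L (f k)) n = L (gramSchmidt ℝ f n) := by
    intro n
    induction n using Nat.strong_induction_on with
    | _ n ih =>
      rw [gramSchmidt_def, gramSchmidt_def ℝ f, map_sub, map_sum]
      congr 1
      refine Finset.sum_congr rfl fun i hi => ?_
      rw [ih i (Finset.mem_Iio.1 hi), Submodule.starProjection_singleton,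
        Submodule.starProjection_singleton, hL, hnorm, map_smul]
  rw [gramSchmidtNormed, gramSchmidtNormed, h, hnorm, map_smul]

theorem gramSchmidtNormed_mem_span (f : ℕ → E) (n : ℕ) :
    gramSchmidtNormed ℝ f n ∈ Submodule.span ℝ (Set.range f) := by
  rw [← span_gramSchmidt ℝ f, ← span_gramSchmidtNormed_range]
  exact Submodule.subset_span ⟨n, rfl⟩

/-- An orthonormal family is a Hilbert basis of a closed subspace. -/
theorem exists_hilbertBasis_of_orthonormal {ι : Type*} [CompleteSpace E] {v : ι → E}
    (hv : Orthonormal ℝ v) :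
    ∃ P : Submodule ℝ E, IsClosed (P : Set E) ∧
      ∃ b : HilbertBasis ι ℝ P, ∀ i, (b i : E) = v i := by
  classical
  let V := hv.orthogonalFamily.linearIsometry
  refine ⟨LinearMap.range V.toLinearMap, ?_, ⟨V.equivRange.symm⟩, fun i => ?_⟩
  · exact V.isometry.isUniformInducing.isComplete_range.isClosed
  · have h : ((V.equivRange (lp.single 2 i (1 : ℝ)) : LinearMap.range V.toLinearMap) : E)
        = v i := by
      change V (lp.single 2 i (1 : ℝ)) = v i
      rw [OrthogonalFamily.linearIsometry_apply_single]
      simp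
    exact h

end GramSchmidt

/-! ### Symmetries and inner products of the orthonormal polynomials. -/

theorem toL2_smul (c : ℝ) (u : C(SG q, ℝ)) : toL2 q (c • u) = c • toL2 q u :=
  map_smul (ContinuousMap.toLp (E := ℝ) 2 (mu q) ℝ) c u

/-- The pullback times the sign is an isometry that carries the monomials at $q_{\pi(n)}$ to those
at $q_n$, and Gram–Schmidt commutes with it. -/
theorem smul_pullL2_antisymOP (hq : IsEquilateral q) (π : Equiv.Perm (Fin 3)) (n : Fin 3)
    (j : ℕ) : sgn π • pullL2 hq π (antisymOP q (π n) j) = antisymOP q n j := by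
  have h := gramSchmidtNormed_map (sgn π • (pullL2 hq π).toLinearMap) (fun x y => by
    change inner ℝ (sgn π • pullL2 hq π x) (sgn π • pullL2 hq π y) = _
    rw [inner_smul_left, inner_smul_right, LinearIsometry.inner_map_map, conj_trivial, ← mul_assoc,
      sgn_mul_self, one_mul]) (fun k => toL2 q (monomial q (π n) k 3)) j
  refine Eq.trans h.symm ?_
  rw [antisymOP]
  congr 1
  funext k
  change sgn π • pullL2 hq π (toL2 q (monomial q (π n) k 3)) = _
  rw [pullL2_toL2, ← toL2_smul, smul_pull_monomial_three]

theorem pullL2_symOP (hq : IsEquilateral q) (π : Equiv.Perm (Fin 3)) (j : ℕ) :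
    pullL2 hq π (symOP q j) = symOP q j := by
  have h := gramSchmidtNormed_map (pullL2 hq π).toLinearMap
    (fun x y => (pullL2 hq π).inner_map_map x y) (fun k => toL2 q (symMonomial q k)) j
  refine Eq.trans h.symm ?_
  rw [symOP]
  congr 1
  funext k
  change pullL2 hq π (toL2 q (symMonomial q k)) = _
  rw [pullL2_toL2, pull_symMonomial]

/-- The rotation that takes the vertex `n` to the vertex `0`. -/
def rotation (n : Fin 3) : Equiv.Perm (Fin 3) := Equiv.subRight n

theorem rotation_self (n : Fin 3) : rotation n n = 0 := sub_self n

theorem sgn_rotation (n : Fin 3) : sgn (rotation n) = 1 := by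
  have h : Equiv.Perm.sign (rotation n) = 1 := by revert n; decide
  simp [sgn, h]

theorem sum_antisymOP (hq : IsEquilateral q) (j : ℕ) : ∑ n, antisymOP q n j = 0 := by
  -- The sum of the rotations kills every monomial $P_{k3}^{(0)}$, hence their span, which contains
  -- `antisymOP q 0 j`; on that vector it is the desired sum.
  let K : L2SG q →ₗ[ℝ] L2SG q := ∑ n, (pullL2 hq (rotation n)).toLinearMap
  have hK : ∀ x, K x = ∑ n, pullL2 hq (rotation n) x := fun x => by
    simp [K]
  have h1 : ∀ k, K (toL2 q (monomial q 0 k 3)) = 0 := by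
    intro k
    have h2 : ∀ n, pullL2 hq (rotation n) (toL2 q (monomial q 0 k 3))
        = toL2 q (monomial q n k 3) := by
      intro n
      have h3 := smul_pull_monomial_three hq (rotation n) n k
      rw [sgn_rotation, one_smul, rotation_self] at h3
      rw [pullL2_toL2, h3]
    rw [hK, Finset.sum_congr rfl fun n _ => h2 n]
    have h4 := map_sum (ContinuousMap.toLp (E := ℝ) 2 (mu q) ℝ) (fun n => monomial q n k 3)
      Finset.univ
    rw [sum_monomial_three hq, map_zero] at h4
    exact h4.symm
  have h5 : antisymOP q 0 j ∈ LinearMap.ker K := by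
    refine (Submodule.span_le.2 ?_) (gramSchmidtNormed_mem_span _ j)
    rintro _ ⟨k, rfl⟩
    exact h1 k
  rw [LinearMap.mem_ker, hK] at h5
  rw [← h5]
  refine Finset.sum_congr rfl fun n _ => ?_
  have h := smul_pullL2_antisymOP hq (rotation n) n j
  rw [sgn_rotation, one_smul, rotation_self] at h
  exact h.symm

theorem orthonormal_antisymOP (hq : IsEquilateral q) (n : Fin 3) :
    Orthonormal ℝ (antisymOP q n) :=
  InnerProductSpace.gramSchmidtNormed_orthonormal (linearIndependent_monomial_three hq n)

theorem orthonormal_symOP (hq : IsEquilateral q) : Orthonormal ℝ (symOP q) :=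
  InnerProductSpace.gramSchmidtNormed_orthonormal (linearIndependent_symMonomial hq)

theorem pullL2_reflection_antisymOP (hq : IsEquilateral q) (k n : Fin 3) (j : ℕ) :
    antisymOP q n j = -pullL2 hq (reflection k) (antisymOP q (reflection k n) j) := by
  rw [← smul_pullL2_antisymOP hq (reflection k) n j, sgn_reflection, neg_one_smul]

theorem inner_antisymOP_symOP (hq : IsEquilateral q) (n : Fin 3) (j k : ℕ) :
    inner ℝ (antisymOP q n j) (symOP q k) = 0 := by
  have h : inner ℝ (antisymOP q n j) (symOP q k) = -inner ℝ (antisymOP q n j) (symOP q k) := by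
    conv_lhs => rw [pullL2_reflection_antisymOP hq n n, ← pullL2_symOP hq (reflection n) k,
      inner_neg_left, LinearIsometry.inner_map_map, reflection_self]
  linarith

/-- The reflection fixing $q_n$ equates the inner products with the other two vertices, and the
vanishing sum makes them add up to $-\delta_{jk}$. -/
theorem inner_antisymOP_of_ne (hq : IsEquilateral q) {n l : Fin 3} (hnl : n ≠ l) (j k : ℕ) :
    inner ℝ (antisymOP q n j) (antisymOP q l k) = -(if j = k then 1 else 0) / 2 := by
  have h1 : inner ℝ (antisymOP q n j) (antisymOP q (n + 1) k)
      = inner ℝ (antisymOP q n j) (antisymOP q (n - 1) k) := by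
    conv_lhs => rw [pullL2_reflection_antisymOP hq n n, pullL2_reflection_antisymOP hq n (n + 1),
      inner_neg_neg, LinearIsometry.inner_map_map, reflection_self, reflection_add]
  have h2 : antisymOP q n k + antisymOP q (n + 1) k + antisymOP q (n - 1) k = 0 := by
    have h := letters_ne n
    have h3 : (Finset.univ : Finset (Fin 3)) = {n, n + 1, n - 1} := by
      clear hnl h1 h; revert n; decide
    have h4 := sum_antisymOP hq k
    rwa [h3, Finset.sum_insert (by simp [h.1.symm, h.2.1.symm]), Finset.sum_pair h.2.2.symm,
      ← add_assoc] at h4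
  have h3 := congrArg (fun x => inner ℝ (antisymOP q n j) x) h2
  simp only [inner_add_right, inner_zero_right,
    orthonormal_iff_ite.1 (orthonormal_antisymOP hq n) j k] at h3
  rcases eq_or_eq_add_or_eq_sub n l with rfl | rfl | rfl
  · exact absurd rfl hnl
  · linarith
  · linarith

theorem orthonormal_phi (hq : IsEquilateral q) :
    Orthonormal ℝ fun p : ℕ × Fin 3 => phi q p.1 p.2 := by
  rw [orthonormal_iff_ite]
  rintro ⟨j, n⟩ ⟨k, l⟩
  have hS := orthonormal_iff_ite.1 (orthonormal_symOP hq) j k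
  have hQS := inner_antisymOP_symOP hq n j k
  have hSQ : inner ℝ (symOP q j) (antisymOP q l k) = 0 := by
    rw [real_inner_comm, inner_antisymOP_symOP hq]
  have e1 : √(2 / 3 : ℝ) * √(2 / 3 : ℝ) = 2 / 3 := Real.mul_self_sqrt (by norm_num)
  have e2 : √(1 / 3 : ℝ) * √(1 / 3 : ℝ) = 1 / 3 := Real.mul_self_sqrt (by norm_num)
  have h : inner ℝ (phi q j n) (phi q k l)
      = 2 / 3 * inner ℝ (antisymOP q n j) (antisymOP q l k) + 1 / 3 * (if j = k then 1 else 0) := by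
    simp only [phi, inner_add_left, inner_add_right, real_inner_smul_left, real_inner_smul_right,
      hS, hQS, hSQ]
    linear_combination inner ℝ (antisymOP q n j) (antisymOP q l k) * e1
      + (if j = k then 1 else 0) * e2
  change inner ℝ (phi q j n) (phi q k l) = _
  rw [h]
  rcases eq_or_ne n l with rfl | hnl
  · rw [orthonormal_iff_ite.1 (orthonormal_antisymOP hq n) j k]
    by_cases hjk : j = k
    · simp [hjk]; norm_num
    · simp [hjk]
  · rw [inner_antisymOP_of_ne hq hnl]
    by_cases hjk : j = k
    · simp [hjk, hnl]; norm_num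
    · simp [hjk]

end SierpinskiGasket

end

theorem theorem4p2 (q : Fin 3 → SierpinskiGasket.Plane)
    (hq : SierpinskiGasket.IsEquilateral q) :
    Orthonormal ℝ (fun p : ℕ × Fin 3 => SierpinskiGasket.phi q p.1 p.2) ∧
    ∃ P : Submodule ℝ (SierpinskiGasket.L2SG q), IsClosed (P : Set (SierpinskiGasket.L2SG q)) ∧
      ∃ b : HilbertBasis (ℕ × Fin 3) ℝ P,
        ∀ p : ℕ × Fin 3, (b p : SierpinskiGasket.L2SG q) = SierpinskiGasket.phi q p.1 p.2 :=
  ⟨SierpinskiGasket.orthonormal_phi hq,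
    SierpinskiGasket.exists_hilbertBasis_of_orthonormal (SierpinskiGasket.orthonormal_phi hq)⟩
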